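/- There exists a continuous, strictly increasing function $L:[0,\infty)\to\mathbb{R}$ with $L(x)=0$ if and only if $x=0$ (hence $L\ge 0$), and an absolute constant $C>0$, such that the following hold. (1) Let $D$ be a real-valued random variable and $V$ a random variable with values in an arbitrary measurable space, defined on a common probability space, such that the (regular) conditional distribution $\langle D|V=v\rangle$ of $D$ given $V=v$ is discrete (carried by a countable set) for $P_V$-almost every $v$. Write $H(D|V)=\mathbb{E}_V[H(D|V=v)]$, where $H(D|V=v)=-\sum_{x}p_v(x)\log_2 p_v(x)$ with $p_v(x)=\mathbb{P}(D=x\mid V=v)$, and suppose that $H(D|V)<\infty$. If $(D',V')$ is an independent copy of $(D,V)$, then $H(D+D'|V,V')<\infty$ and $$H(D+D'|V,V')-H(D|V)\ \ge\ L\big(H(D|V)\big).$$ (2) $L(x)\ge C\,x^4$ for all $0\le x<4$. -/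

import Mathlib

open MeasureTheory ProbabilityTheory Set
open scoped ENNReal

universe u v

/-- A measure on `ℝ` is discrete if it is carried by a countable set. -/
def IsDiscreteMeasure (ν : Measure ℝ) : Prop :=
  ∃ S : Set ℝ, S.Countable ∧ ν Sᶜ = 0

/-- Shannon entropy, in bits, of a (discrete) probability measure on `ℝ`:
`H(ν) = ∑ₓ -ν{x} log₂ ν{x}`, possibly `∞`. -/
noncomputable def discreteEntropy (ν : Measure ℝ) : ℝ≥0∞ :=
  ∑' x : ℝ, ENNReal.ofReal (-(ν.real {x} * Real.logb 2 (ν.real {x})))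

section CondEntropy

variable {Ω 𝒱 : Type*} [MeasurableSpace Ω] [MeasurableSpace 𝒱]

/-- The conditional distribution `⟨D|V⟩` is discrete: for `P_V`-almost every `v`,
`⟨D|V = v⟩` is discrete. -/
def IsDiscreteCond (D : Ω → ℝ) (V : Ω → 𝒱) (μ : Measure Ω) [IsFiniteMeasure μ] : Prop :=
  ∀ᵐ v ∂(μ.map V), IsDiscreteMeasure (condDistrib D V μ v)

/-- Conditional entropy `H(D|V) = 𝔼_V[H(D|V = v)]`, where `H(D|V = v)` is the entropy of the
regular conditional distribution of `D` given `V = v`. -/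
noncomputable def condEntropy (D : Ω → ℝ) (V : Ω → 𝒱) (μ : Measure Ω) [IsFiniteMeasure μ] :
    ℝ≥0∞ :=
  ∫⁻ v, discreteEntropy (condDistrib D V μ v) ∂(μ.map V)

end CondEntropy

/-! Fix values v, v' of the conditioning variables. The conditional law of D + D' is then the
convolution of two discrete laws, so the core is a bound for independent discrete X ∼ ν and Y ∼ ρ:
if both entropies are at least y ≤ 1, then H(X+Y) exceeds (H(X)+H(Y))/2 by a multiple of y⁴
(`natEntropy_conv_gap`).

Since H(X+Y) - H(X) is the mutual information of X+Y and Y, it is nonnegative, and strictly positive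
once an event of X+Y is correlated with an event of Y (`toReal_natEntropy_add_cov_le`). The order of
ℝ supplies such events: cut X at a and Y at b; {X+Y ≤ a+b} contains {X ≤ a, Y ≤ b} and misses {X >
a, Y > b}, hence is correlated with {X ≤ a} or with {Y ≤ b} (`le_covariance_of_cut`). If the cuts
leave mass t on each side, the gain is of order t³.

Good cuts exist unless one law is nearly a point mass (`exists_cut`). If an atom leaves mass η
outside it, either a direct bound by conditioning on that atom already gives a gain of order y, or
binary entropy forces η³ to be at least of order y⁴ (`natEntropy_conv_ge_or_atom`). With t of order
η this yields y⁴.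

Averaging over (v, v') must also cover the case where H(D|V) is concentrated on a small set of v.
There the gain comes from H(X+Y) ≥ max(H(X), H(Y)), whose mean over independent v, v' is well above
that of H(X) (`lintegral_add_gap_le`). -/

/-- Shannon entropy in nats of a discrete probability measure, as the mean of its
information content. -/
noncomputable def natEntropy (ν : Measure ℝ) : ℝ≥0∞ :=
  ∫⁻ x, ENNReal.ofReal (-Real.log (ν.real {x})) ∂ν

/-! ### Measurability of the entropy and reduction to atoms -/

lemma measurable_kernel_singleton {α : Type*} [MeasurableSpace α] (κ : Kernel α ℝ)
    [IsSFiniteKernel κ] : Measurable fun p : α × ℝ => κ p.1 {p.2} := by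
  have ht : MeasurableSet {w : (α × ℝ) × ℝ | w.2 = w.1.2} :=
    measurableSet_eq_fun measurable_snd (measurable_snd.comp measurable_fst)
  exact Kernel.measurable_kernel_prodMk_left (κ := κ.comap Prod.fst measurable_fst) ht

lemma measurable_measureReal_singleton (ν : Measure ℝ) [IsFiniteMeasure ν] :
    Measurable fun x => ν.real {x} :=
  ((measurable_kernel_singleton (Kernel.const Unit ν)).comp
    (measurable_prodMk_left (x := ()))).ennreal_toReal

lemma measurable_log_measureReal_singleton (ν : Measure ℝ) [IsFiniteMeasure ν] :
    Measurable fun x => Real.log (ν.real {x}) :=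
  Real.measurable_log.comp (measurable_measureReal_singleton ν)

lemma measurable_ofReal_neg_log_measureReal_singleton (ν : Measure ℝ) [IsFiniteMeasure ν] :
    Measurable fun x => ENNReal.ofReal (-Real.log (ν.real {x})) :=
  (measurable_log_measureReal_singleton ν).neg.ennreal_ofReal

/-- This is why `natEntropy` is an integral: the sum over all of ℝ in `discreteEntropy` is
uncountable and gives no direct access to measurability in the parameter. -/
lemma measurable_natEntropy_kernel {α : Type*} [MeasurableSpace α] (κ : Kernel α ℝ)
    [IsSFiniteKernel κ] : Measurable fun a => natEntropy (κ a) := by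
  have h : Measurable fun p : α × ℝ => ENNReal.ofReal (-Real.log ((κ p.1).real {p.2})) :=
    (Real.measurable_log.comp
      (measurable_kernel_singleton κ).ennreal_toReal).neg.ennreal_ofReal
  exact h.lintegral_kernel_prod_right'

namespace IsDiscreteMeasure

variable {ν ρ : Measure ℝ}

lemma lintegral_eq_tsum (h : IsDiscreteMeasure ν) (f : ℝ → ℝ≥0∞) :
    ∫⁻ x, f x ∂ν = ∑' x, f x * ν {x} := by
  obtain ⟨S, hS, h0⟩ := h
  have hr : ν.restrict S = ν := Measure.restrict_eq_self_of_ae_mem (by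
    rw [ae_iff]; exact h0)
  have h1 : ∀ x ∉ S, ν {x} = 0 := fun x hx =>
    measure_mono_null (singleton_subset_iff.2 hx) h0
  conv_lhs => rw [← hr]
  rw [lintegral_countable f hS]
  refine tsum_subtype_eq_of_support_subset (f := fun x => f x * ν {x}) fun x hx => ?_
  by_contra hxS
  exact hx (by simp [h1 x hxS])

lemma ae_measureReal_pos [IsFiniteMeasure ν] (h : IsDiscreteMeasure ν) :
    ∀ᵐ x ∂ν, 0 < ν.real {x} := by
  obtain ⟨S, hS, h0⟩ := h
  have h1 : ν ({x | ν {x} = 0} ∩ S) = 0 := by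
    have : ({x | ν {x} = 0} ∩ S) = ⋃ x ∈ ({x | ν {x} = 0} ∩ S), {x} :=
      (biUnion_of_singleton _).symm
    rw [this, measure_biUnion_null_iff (hS.mono inter_subset_right)]
    exact fun x hx => hx.1
  have h2 : ∀ᵐ x ∂ν, x ∈ S := by rw [ae_iff]; exact h0
  filter_upwards [h2, measure_eq_zero_iff_ae_notMem.1 h1] with x hx hx'
  refine ENNReal.toReal_pos (fun h => hx' ⟨h, hx⟩) (measure_ne_top _ _)

lemma conv [SFinite ρ] (hν : IsDiscreteMeasure ν) (hρ : IsDiscreteMeasure ρ) :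
    IsDiscreteMeasure (ν ∗ ρ) := by
  obtain ⟨S, hS, h0⟩ := hν
  obtain ⟨T, hT, h1⟩ := hρ
  refine ⟨(fun x : ℝ × ℝ => x.1 + x.2) '' (S ×ˢ T), (hS.prod hT).image _, ?_⟩
  have hm := ((hS.prod hT).image (fun x : ℝ × ℝ => x.1 + x.2)).measurableSet
  rw [Measure.conv, Measure.map_apply (by fun_prop) hm.compl]
  refine measure_mono_null (t := (Sᶜ ×ˢ univ) ∪ (univ ×ˢ Tᶜ)) ?_ ?_
  · rintro ⟨x, y⟩ hxy
    by_contra hc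
    simp only [mem_union, mem_prod, mem_univ, and_true, true_and, mem_compl_iff, not_or,
      not_not] at hc
    exact hxy ⟨(x, y), hc, rfl⟩
  · rw [measure_union_null_iff]
    simp [Measure.prod_prod, h0, h1]

lemma discreteEntropy_eq [IsProbabilityMeasure ν] (h : IsDiscreteMeasure ν) :
    discreteEntropy ν = natEntropy ν / ENNReal.ofReal (Real.log 2) := by
  have hl : 0 < Real.log 2 := Real.log_pos (by norm_num)
  rw [natEntropy, h.lintegral_eq_tsum, discreteEntropy, div_eq_mul_inv, ← ENNReal.tsum_mul_right]
  refine tsum_congr fun x => ?_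
  rw [← ENNReal.ofReal_inv_of_pos hl, ← ofReal_measureReal, ← ENNReal.ofReal_mul
    (neg_nonneg.2 (Real.log_nonpos measureReal_nonneg measureReal_le_one)),
    ← ENNReal.ofReal_mul]
  · congr 1
    rw [Real.logb]; ring
  · exact mul_nonneg (neg_nonneg.2 (Real.log_nonpos measureReal_nonneg measureReal_le_one))
      measureReal_nonneg

end IsDiscreteMeasure

/-! ### Convolution and subadditivity of entropy -/

lemma mul_measureReal_singleton_le_conv (ν ρ : Measure ℝ) [IsFiniteMeasure ν] [IsFiniteMeasure ρ]
    (x y : ℝ) : ν.real {x} * ρ.real {y} ≤ (ν ∗ ρ).real {x + y} := by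
  rw [← measureReal_prod_prod, Measure.conv, map_measureReal_apply (by fun_prop) (by measurability)]
  refine measureReal_mono ?_
  rintro ⟨a, b⟩ ⟨rfl, rfl⟩
  rfl

lemma natEntropy_conv_eq (ν ρ : Measure ℝ) [IsFiniteMeasure ν] [IsFiniteMeasure ρ] :
    natEntropy (ν ∗ ρ) =
      ∫⁻ w, ENNReal.ofReal (-Real.log ((ν ∗ ρ).real {w.1 + w.2})) ∂(ν.prod ρ) := by
  rw [natEntropy]
  exact lintegral_map (measurable_ofReal_neg_log_measureReal_singleton (ν ∗ ρ)) (by fun_prop)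

section ProbabilityMeasure

variable {ν ρ : Measure ℝ} [IsProbabilityMeasure ν] [IsProbabilityMeasure ρ]

lemma neg_log_measureReal_nonneg (x : ℝ) : 0 ≤ -Real.log (ν.real {x}) :=
  neg_nonneg.2 (Real.log_nonpos measureReal_nonneg measureReal_le_one)

lemma integrable_log_of_natEntropy_lt_top (h : natEntropy ν < ∞) :
    Integrable (fun x => Real.log (ν.real {x})) ν := by
  have hm := (measurable_log_measureReal_singleton ν).neg.aestronglyMeasurable (μ := ν)
  have : Integrable (fun x => -Real.log (ν.real {x})) ν := ⟨hm, by
    rw [hasFiniteIntegral_iff_ofReal (ae_of_all _ neg_log_measureReal_nonneg)]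
    exact h⟩
  simpa using this.neg

lemma integral_neg_log_eq_toReal_natEntropy :
    ∫ x, -Real.log (ν.real {x}) ∂ν = (natEntropy ν).toReal :=
  integral_eq_lintegral_of_nonneg_ae (ae_of_all _ neg_log_measureReal_nonneg)
    (measurable_log_measureReal_singleton ν).neg.aestronglyMeasurable

lemma ae_prod_measureReal_pos (hν : IsDiscreteMeasure ν) (hρ : IsDiscreteMeasure ρ) :
    ∀ᵐ w ∂(ν.prod ρ), 0 < ν.real {w.1} ∧ 0 < ρ.real {w.2} :=
  (Measure.quasiMeasurePreserving_fst.ae hν.ae_measureReal_pos).and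
    (Measure.quasiMeasurePreserving_snd.ae hρ.ae_measureReal_pos)

/-- The atom of the convolution at x + y has mass at least ν{x} ρ{y}; take -log and integrate over
the product. -/
lemma natEntropy_conv_le (hν : IsDiscreteMeasure ν) (hρ : IsDiscreteMeasure ρ) :
    natEntropy (ν ∗ ρ) ≤ natEntropy ν + natEntropy ρ := by
  have hm := measurable_ofReal_neg_log_measureReal_singleton ν
  have hm' := measurable_ofReal_neg_log_measureReal_singleton ρ
  have h1 := (measurePreserving_fst (μ := ν) (ν := ρ)).lintegral_comp hm
  have h2 := (measurePreserving_snd (μ := ν) (ν := ρ)).lintegral_comp hm'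
  rw [natEntropy_conv_eq, natEntropy, natEntropy, ← h1, ← h2,
    ← lintegral_add_left (f := fun w : ℝ × ℝ => ENNReal.ofReal (-Real.log (ν.real {w.1})))
      (hm.comp measurable_fst)]
  refine lintegral_mono_ae ?_
  filter_upwards [ae_prod_measureReal_pos hν hρ] with w hw
  rw [← ENNReal.ofReal_add (neg_log_measureReal_nonneg _) (neg_log_measureReal_nonneg _)]
  refine ENNReal.ofReal_le_ofReal ?_
  have := Real.log_le_log (mul_pos hw.1 hw.2) (mul_measureReal_singleton_le_conv ν ρ w.1 w.2)
  rw [Real.log_mul hw.1.ne' hw.2.ne'] at this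
  linarith

end ProbabilityMeasure

/-! ### Entropy of a convolution bounded below by change of measure -/

section ConvolutionBounds

variable {ν ρ : Measure ℝ} [IsProbabilityMeasure ν] [IsProbabilityMeasure ρ]

/-- The density cancels ν{x} at every atom of ν, and translation by y is a bijection; only the atoms
of τ missed by the translated ν are lost. -/
lemma lintegral_div_mul_le {τ : Measure ℝ} [IsProbabilityMeasure τ] (hν : IsDiscreteMeasure ν)
    (hτ : IsDiscreteMeasure τ) (y : ℝ) (f : ℝ → ℝ≥0∞) :
    ∫⁻ x, ENNReal.ofReal (τ.real {x + y} / ν.real {x}) * f (x + y) ∂ν ≤ ∫⁻ z, f z ∂τ := by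
  rw [hν.lintegral_eq_tsum, hτ.lintegral_eq_tsum, 
    ← (Equiv.addRight y).tsum_eq (fun z => f z * τ {z})]
  refine ENNReal.tsum_le_tsum fun x => ?_
  rw [mul_right_comm, mul_comm (f _), Equiv.coe_addRight]
  refine mul_le_mul' ?_ le_rfl
  rw [← ofReal_measureReal (μ := ν), ← ofReal_measureReal (μ := τ),
    ← ENNReal.ofReal_mul (by positivity)]
  refine ENNReal.ofReal_le_ofReal ?_
  rcases eq_or_ne (ν.real {x}) 0 with h | h
  · simp [h]
  · rw [div_mul_cancel₀ _ h]

/-- Gibbs' inequality for a comparison weight k whose ratio has mass at most c: integrate log s ≤ s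
- 1 at s = (ν ∗ ρ){x+y} / k(x, y). The two lower bounds below are two choices of k. -/
lemma integral_neg_log_le_of_lintegral_le (hν : IsDiscreteMeasure ν) (hρ : IsDiscreteMeasure ρ)
    (hR : natEntropy (ν ∗ ρ) < ∞) {k : ℝ × ℝ → ℝ} (hk : Measurable k)
    (hpos : ∀ᵐ w ∂(ν.prod ρ), 0 < k w) (hint : Integrable (fun w => Real.log (k w)) (ν.prod ρ))
    {c : ℝ} (hc : 0 ≤ c)
    (h : ∫⁻ w, ENNReal.ofReal ((ν ∗ ρ).real {w.1 + w.2} / k w) ∂(ν.prod ρ) ≤ ENNReal.ofReal c) :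
    ∫ w, -Real.log (k w) ∂(ν.prod ρ) ≤ (natEntropy (ν ∗ ρ)).toReal + (c - 1) := by
  have hadd : Measurable fun w : ℝ × ℝ => w.1 + w.2 := by fun_prop
  have hrm : Measurable fun w : ℝ × ℝ => (ν ∗ ρ).real {w.1 + w.2} :=
    (measurable_measureReal_singleton (ν ∗ ρ)).comp hadd
  have hri : Integrable (fun w : ℝ × ℝ => -Real.log ((ν ∗ ρ).real {w.1 + w.2})) (ν.prod ρ) := by
    refine ⟨hrm.log.neg.aestronglyMeasurable, ?_⟩
    rw [hasFiniteIntegral_iff_ofReal (ae_of_all _ fun w => neg_log_measureReal_nonneg _),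
      ← natEntropy_conv_eq]
    exact hR
  have hre : ∫ w, -Real.log ((ν ∗ ρ).real {w.1 + w.2}) ∂(ν.prod ρ)
      = (natEntropy (ν ∗ ρ)).toReal := by
    rw [natEntropy_conv_eq]
    exact integral_eq_lintegral_of_nonneg_ae
      (ae_of_all _ fun w => neg_log_measureReal_nonneg _) hrm.log.neg.aestronglyMeasurable
  have hq0 : 0 ≤ᵐ[ν.prod ρ] fun w => (ν ∗ ρ).real {w.1 + w.2} / k w := by
    filter_upwards [hpos] with w hw
    exact div_nonneg measureReal_nonneg hw.le
  have hqm := (hrm.div hk).aestronglyMeasurable (μ := ν.prod ρ)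
  have hqi : Integrable (fun w => (ν ∗ ρ).real {w.1 + w.2} / k w) (ν.prod ρ) := by
    refine ⟨hqm, ?_⟩
    rw [hasFiniteIntegral_iff_ofReal hq0]
    exact h.trans_lt ENNReal.ofReal_lt_top
  have hqe : ∫ w, (ν ∗ ρ).real {w.1 + w.2} / k w ∂(ν.prod ρ) ≤ c := by
    rw [integral_eq_lintegral_of_nonneg_ae hq0 hqm]
    exact ENNReal.toReal_le_of_le_ofReal hc h
  have hle : ∫ w, -Real.log (k w) ∂(ν.prod ρ) ≤
      ∫ w, (-Real.log ((ν ∗ ρ).real {w.1 + w.2}) + ((ν ∗ ρ).real {w.1 + w.2} / k w - 1))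
        ∂(ν.prod ρ) := by
    refine integral_mono_ae hint.neg (hri.add (hqi.sub (integrable_const 1))) ?_
    filter_upwards [hpos, ae_prod_measureReal_pos hν hρ] with w hw hw'
    have hr : 0 < (ν ∗ ρ).real {w.1 + w.2} :=
      (mul_pos hw'.1 hw'.2).trans_le (mul_measureReal_singleton_le_conv ν ρ w.1 w.2)
    have := Real.log_le_sub_one_of_pos (div_pos hr hw)
    rw [Real.log_div hr.ne' hw.ne'] at this
    change -Real.log (k w) ≤ _
    linarith
  have hsum := integral_add hri (hqi.sub (integrable_const 1))
  have hsub := integral_sub hqi (integrable_const (1 : ℝ))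
  simp only [Pi.sub_apply, integral_const, probReal_univ, smul_eq_mul, one_mul] at hsum hsub
  linarith

/-- A Donsker–Varadhan type bound for the mutual information of X+Y and Y, with test function g: the
mean of g under the joint law is compared with that of exp g - 1 under the product of the marginals.
It is Gibbs' inequality with k = ν{x} exp(-g(x+y, y)). -/
lemma toReal_natEntropy_add_integral_le (hν : IsDiscreteMeasure ν) (hρ : IsDiscreteMeasure ρ)
    (hA : natEntropy ν < ∞) (hR : natEntropy (ν ∗ ρ) < ∞) {g : ℝ × ℝ → ℝ} (hg : Measurable g)
    (hgi : Integrable (fun w : ℝ × ℝ => g (w.1 + w.2, w.2)) (ν.prod ρ))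
    (hge : Integrable (fun w => Real.exp (g w)) ((ν ∗ ρ).prod ρ)) :
    (natEntropy ν).toReal + ∫ w, g (w.1 + w.2, w.2) ∂(ν.prod ρ) ≤
      (natEntropy (ν ∗ ρ)).toReal + (∫ w, Real.exp (g w) ∂((ν ∗ ρ).prod ρ) - 1) := by
  have hsh : Measurable fun w : ℝ × ℝ => (w.1 + w.2, w.2) := by fun_prop
  have hadd : Measurable fun w : ℝ × ℝ => w.1 + w.2 := by fun_prop
  have hpm : Measurable fun w : ℝ × ℝ => ν.real {w.1} :=
    (measurable_measureReal_singleton ν).comp measurable_fst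
  have hrm : Measurable fun w : ℝ × ℝ => (ν ∗ ρ).real {w.1 + w.2} :=
    (measurable_measureReal_singleton (ν ∗ ρ)).comp hadd
  have hgm : Measurable fun w : ℝ × ℝ => g (w.1 + w.2, w.2) := hg.comp hsh
  have hk : Measurable fun w : ℝ × ℝ => ν.real {w.1} * Real.exp (-g (w.1 + w.2, w.2)) :=
    hpm.mul hgm.neg.exp
  have hp := ae_prod_measureReal_pos hν hρ
  have hlog : (fun w : ℝ × ℝ => Real.log (ν.real {w.1} * Real.exp (-g (w.1 + w.2, w.2))))
      =ᵐ[ν.prod ρ] fun w => Real.log (ν.real {w.1}) - g (w.1 + w.2, w.2) := by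
    filter_upwards [hp] with w hw
    rw [Real.log_mul hw.1.ne' (Real.exp_pos _).ne', Real.log_exp]
    ring
  have hpi : Integrable (fun w : ℝ × ℝ => Real.log (ν.real {w.1})) (ν.prod ρ) :=
    (integrable_log_of_natEntropy_lt_top hA).comp_fst ρ
  have hpe : ∫ w, Real.log (ν.real {w.1}) ∂(ν.prod ρ) = -(natEntropy ν).toReal := by
    rw [← integral_neg_log_eq_toReal_natEntropy, integral_neg, neg_neg,
      integral_fun_fst (fun x => Real.log (ν.real {x}))]
    simp
  have hdm : Measurable fun w : ℝ × ℝ => (ν ∗ ρ).real {w.1 + w.2} /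
      (ν.real {w.1} * Real.exp (-g (w.1 + w.2, w.2))) := hrm.div hk
  have key := integral_neg_log_le_of_lintegral_le (c := ∫ w, Real.exp (g w) ∂((ν ∗ ρ).prod ρ))
    hν hρ hR hk
    (hp.mono fun w hw => mul_pos hw.1 (Real.exp_pos _)) ((hpi.sub hgi).congr hlog.symm)
    (integral_nonneg fun w => (Real.exp_pos (g w)).le) ?_
  · rw [integral_neg, integral_congr_ae hlog, integral_sub hpi hgi, hpe] at key
    linarith
  · rw [ofReal_integral_eq_lintegral_ofReal hge (ae_of_all _ fun w => (Real.exp_pos _).le),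
      lintegral_prod_symm _ hdm.ennreal_ofReal.aemeasurable,
      lintegral_prod_symm _ hg.exp.ennreal_ofReal.aemeasurable]
    refine lintegral_mono fun y => ?_
    refine le_trans (le_of_eq (lintegral_congr fun x => ?_)) (lintegral_div_mul_le hν
      (hν.conv hρ) y fun z => ENNReal.ofReal (Real.exp (g (z, y))))
    rw [← ENNReal.ofReal_mul (by positivity), Real.exp_neg]
    congr 1
    field_simp

lemma toReal_natEntropy_le_conv (hν : IsDiscreteMeasure ν) (hρ : IsDiscreteMeasure ρ)
    (hA : natEntropy ν < ∞) (hR : natEntropy (ν ∗ ρ) < ∞) :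
    (natEntropy ν).toReal ≤ (natEntropy (ν ∗ ρ)).toReal := by
  simpa using toReal_natEntropy_add_integral_le hν hρ hA hR (g := fun _ => 0) measurable_const
    (integrable_const _) (integrable_const _)

lemma exp_le_one_add_add_sq {x : ℝ} (hx : |x| ≤ 1) : Real.exp x ≤ 1 + x + x ^ 2 := by
  have := (abs_le.1 (Real.abs_exp_sub_one_sub_id_le hx)).2
  linarith

lemma integral_sq_indicator_sub {B : Set ℝ} (hB : MeasurableSet B) :
    ∫ y, (B.indicator 1 y - ρ.real B) ^ 2 ∂ρ = ρ.real B * (1 - ρ.real B) := by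
  have hi : Integrable (B.indicator (1 : ℝ → ℝ)) ρ := (integrable_const 1).indicator hB
  have h : ∀ y, (B.indicator (1 : ℝ → ℝ) y - ρ.real B) ^ 2 =
      (1 - 2 * ρ.real B) * B.indicator 1 y + ρ.real B ^ 2 := fun y => by
    by_cases hy : y ∈ B
    · simp [hy]; ring
    · simp [hy]
  simp_rw [h]
  rw [integral_add (hi.const_mul _) (integrable_const _), integral_const_mul,
    integral_indicator_one hB]
  simp
  ring

/-- Correlation between {X+Y ∈ S} and {Y ∈ B} forces mutual information: a term linear in l times
the covariance, against a quadratic error given by the variance of the indicator of B. -/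
lemma toReal_natEntropy_add_cov_le (hν : IsDiscreteMeasure ν) (hρ : IsDiscreteMeasure ρ)
    (hA : natEntropy ν < ∞) (hR : natEntropy (ν ∗ ρ) < ∞) {S B : Set ℝ} (hS : MeasurableSet S)
    (hB : MeasurableSet B) {l : ℝ} (hl0 : 0 ≤ l) (hl1 : l ≤ 1) :
    (natEntropy ν).toReal + l * ((ν.prod ρ).real {w | w.1 + w.2 ∈ S ∧ w.2 ∈ B}
        - (ν ∗ ρ).real S * ρ.real B) ≤
      (natEntropy (ν ∗ ρ)).toReal + l ^ 2 * (ρ.real B * (1 - ρ.real B)) := by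
  set s := (ν ∗ ρ).real S with hs
  set β := ρ.real B with hβ
  have hadd : Measurable fun w : ℝ × ℝ => w.1 + w.2 := by fun_prop
  have hSm : Measurable fun z => S.indicator (1 : ℝ → ℝ) z - s :=
    (measurable_one.indicator hS).sub_const s
  have hBm : Measurable fun z => B.indicator (1 : ℝ → ℝ) z - β :=
    (measurable_one.indicator hB).sub_const β
  have hbd : ∀ (T : Set ℝ) (c z : ℝ), 0 ≤ c → c ≤ 1 → |T.indicator (1 : ℝ → ℝ) z - c| ≤ 1 := by
    intro T c z h0 h1
    by_cases hz : z ∈ T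
    · simp only [hz, indicator_of_mem, Pi.one_apply]; rw [abs_le]; constructor <;> linarith
    · simp only [hz, not_false_eq_true, indicator_of_notMem]; rw [abs_le]
      constructor <;> linarith
  have hS1 : ∀ z, |S.indicator (1 : ℝ → ℝ) z - s| ≤ 1 := fun z =>
    hbd S s z measureReal_nonneg measureReal_le_one
  have hB1 : ∀ z, |B.indicator (1 : ℝ → ℝ) z - β| ≤ 1 := fun z =>
    hbd B β z measureReal_nonneg measureReal_le_one
  -- The centred indicators make g integrate to zero under the product of the marginals and to l
  -- times the covariance under the joint law.
  let g : ℝ × ℝ → ℝ := fun w => l * ((S.indicator 1 w.1 - s) * (B.indicator 1 w.2 - β))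
  have hg : Measurable g :=
    ((hSm.comp measurable_fst).mul (hBm.comp measurable_snd)).const_mul l
  have hg1 : ∀ w, |g w| ≤ 1 := fun w => by
    simp only [g, abs_mul, abs_of_nonneg hl0]
    exact mul_le_one₀ hl1 (by positivity) (mul_le_one₀ (hS1 _) (abs_nonneg _) (hB1 _))
  have hsh : Measurable fun w : ℝ × ℝ => (w.1 + w.2, w.2) := by fun_prop
  have hgi : Integrable (fun w : ℝ × ℝ => g (w.1 + w.2, w.2)) (ν.prod ρ) :=
    Integrable.of_bound (hg.comp hsh).aestronglyMeasurable 1 (ae_of_all _ fun w => hg1 _)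
  have hgi' : Integrable g ((ν ∗ ρ).prod ρ) :=
    Integrable.of_bound hg.aestronglyMeasurable 1 (ae_of_all _ fun w => hg1 _)
  have hge : Integrable (fun w => Real.exp (g w)) ((ν ∗ ρ).prod ρ) := by
    refine Integrable.of_bound hg.exp.aestronglyMeasurable (Real.exp 1) (ae_of_all _ fun w => ?_)
    rw [Real.norm_eq_abs, Real.abs_exp, Real.exp_le_exp]
    exact (abs_le.1 (hg1 w)).2
  have hsqi : Integrable (fun w : ℝ × ℝ => l ^ 2 * (B.indicator 1 w.2 - β) ^ 2)
      ((ν ∗ ρ).prod ρ) := by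
    refine Integrable.of_bound
      (((hBm.comp measurable_snd).pow_const 2).const_mul (l ^ 2)).aestronglyMeasurable
      (l ^ 2) (ae_of_all _ fun w => ?_)
    rw [Real.norm_eq_abs, abs_mul, abs_pow, abs_pow, sq_abs]
    exact mul_le_of_le_one_right (sq_nonneg l) (pow_le_one₀ (abs_nonneg _) (hB1 _))
  have hBi : Integrable (B.indicator (1 : ℝ → ℝ)) ρ := (integrable_const 1).indicator hB
  have key := toReal_natEntropy_add_integral_le hν hρ hA hR hg hgi hge
  have hg0 : ∫ w, g w ∂((ν ∗ ρ).prod ρ) = 0 := by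
    simp only [g]
    rw [integral_const_mul, integral_prod_mul (fun z => S.indicator (1 : ℝ → ℝ) z - s)
      (fun y => B.indicator (1 : ℝ → ℝ) y - β), integral_sub hBi (integrable_const _),
      integral_indicator_one hB]
    simp [← hβ]
  have hexp : ∫ w, Real.exp (g w) ∂((ν ∗ ρ).prod ρ) ≤ 1 + l ^ 2 * (β * (1 - β)) := by
    have h1 : ∫ w, Real.exp (g w) ∂((ν ∗ ρ).prod ρ) ≤
        ∫ w : ℝ × ℝ, ((1 + g w) + l ^ 2 * (B.indicator 1 w.2 - β) ^ 2) ∂((ν ∗ ρ).prod ρ) := by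
      refine integral_mono hge (((integrable_const 1).add hgi').add hsqi) fun w => ?_
      refine (exp_le_one_add_add_sq (hg1 w)).trans ?_
      -- Only the B factor is kept in the second-order term, so that the error is a variance
      -- proportional to β(1 - β).
      have h2 : (S.indicator (1 : ℝ → ℝ) w.1 - s) ^ 2 ≤ 1 := by
        rw [← sq_abs]; exact pow_le_one₀ (abs_nonneg _) (hS1 _)
      have h3 : g w ^ 2 ≤ l ^ 2 * (B.indicator 1 w.2 - β) ^ 2 := by
        have h4 : g w ^ 2 = (S.indicator (1 : ℝ → ℝ) w.1 - s) ^ 2 *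
            (l ^ 2 * (B.indicator 1 w.2 - β) ^ 2) := by simp only [g]; ring
        rw [h4]
        exact mul_le_of_le_one_left (by positivity) h2
      change 1 + g w + g w ^ 2 ≤ _
      linarith
    have h1i : Integrable (fun w => 1 + g w) ((ν ∗ ρ).prod ρ) := (integrable_const 1).add hgi'
    rw [integral_add h1i hsqi,
      integral_add (integrable_const 1) hgi', hg0, integral_const_mul,
      integral_fun_snd (fun y => (B.indicator (1 : ℝ → ℝ) y - β) ^ 2),
      integral_sq_indicator_sub hB] at h1
    simpa using h1
  have hcov : ∫ w, g (w.1 + w.2, w.2) ∂(ν.prod ρ) =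
      l * ((ν.prod ρ).real {w | w.1 + w.2 ∈ S ∧ w.2 ∈ B} - s * β) := by
    let T : Set (ℝ × ℝ) := {w | w.1 + w.2 ∈ S}
    let U : Set (ℝ × ℝ) := {w | w.2 ∈ B}
    have hT : MeasurableSet T := hadd hS
    have hU : MeasurableSet U := measurable_snd hB
    have hTr : (ν.prod ρ).real T = s := by
      rw [hs, Measure.conv, map_measureReal_apply hadd hS]; rfl
    have hUr : (ν.prod ρ).real U = β := by
      have : U = univ ×ˢ B := by ext; simp [U]
      rw [this, measureReal_prod_prod]; simp [hβ]
    have hTi : Integrable (T.indicator (1 : ℝ × ℝ → ℝ)) (ν.prod ρ) :=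
      (integrable_const 1).indicator hT
    have hUi : Integrable (U.indicator (1 : ℝ × ℝ → ℝ)) (ν.prod ρ) :=
      (integrable_const 1).indicator hU
    have hTUi : Integrable ((T ∩ U).indicator (1 : ℝ × ℝ → ℝ)) (ν.prod ρ) :=
      (integrable_const 1).indicator (hT.inter hU)
    have h : ∀ w : ℝ × ℝ, g (w.1 + w.2, w.2) = l * ((T ∩ U).indicator 1 w -
        β * T.indicator 1 w - s * U.indicator 1 w + s * β) := fun w => by
      by_cases h1 : w.1 + w.2 ∈ S <;> by_cases h2 : w.2 ∈ B <;> 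
        (simp [g, T, U, h1, h2] <;> ring_nf <;> simp)
    have h1i : Integrable (fun w => (T ∩ U).indicator 1 w - β * T.indicator 1 w) (ν.prod ρ) :=
      hTUi.sub (hTi.const_mul _)
    have h2i : Integrable (fun w => (T ∩ U).indicator 1 w - β * T.indicator 1 w -
        s * U.indicator 1 w) (ν.prod ρ) := h1i.sub (hUi.const_mul _)
    simp_rw [h]
    rw [integral_const_mul, integral_add h2i (integrable_const _), integral_sub h1i (hUi.const_mul _),
      integral_sub hTUi (hTi.const_mul _), integral_const_mul, integral_const_mul,
      integral_indicator_one (hT.inter hU), integral_indicator_one hT, integral_indicator_one hU,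
      hTr, hUr, integral_const, probReal_univ, one_smul]
    have : T ∩ U = {w : ℝ × ℝ | w.1 + w.2 ∈ S ∧ w.2 ∈ B} := rfl
    rw [this]
    ring
  rw [hcov] at key
  linarith

end ConvolutionBounds

/-! ### Conditioning on an atom of one summand -/

section AtomBound

variable {ν ρ : Measure ℝ} [IsProbabilityMeasure ν] [IsProbabilityMeasure ρ]

lemma lintegral_conv_div_atom_le (hν : IsDiscreteMeasure ν) (hρ : IsDiscreteMeasure ρ) (b : ℝ) :
    ∫⁻ w, ENNReal.ofReal ((ν ∗ ρ).real {w.1 + w.2} /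
      (if w.2 = b then ν.real {w.1} else ρ.real {w.2} / (1 - ρ.real {b}))) ∂(ν.prod ρ) ≤
      ENNReal.ofReal 1 := by
  set η := 1 - ρ.real {b} with hη
  have hη0 : 0 ≤ η := sub_nonneg.2 measureReal_le_one
  have hadd : Measurable fun w : ℝ × ℝ => w.1 + w.2 := by fun_prop
  have hrm : Measurable fun w : ℝ × ℝ => (ν ∗ ρ).real {w.1 + w.2} :=
    (measurable_measureReal_singleton (ν ∗ ρ)).comp hadd
  have hpm : Measurable fun w : ℝ × ℝ => ν.real {w.1} :=
    (measurable_measureReal_singleton ν).comp measurable_fst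
  have hqm : Measurable fun w : ℝ × ℝ => ρ.real {w.2} :=
    (measurable_measureReal_singleton ρ).comp measurable_snd
  -- F₁ covers y = b and has mass at most ρ{b}; F₂ is extended to all y, which costs nothing, as its
  -- mass is still at most η.
  let F₁ : ℝ × ℝ → ℝ≥0∞ := fun w =>
    ENNReal.ofReal ((ν ∗ ρ).real {w.1 + w.2} / ν.real {w.1}) * ({b} : Set ℝ).indicator 1 w.2
  let F₂ : ℝ × ℝ → ℝ≥0∞ := fun w =>
    ENNReal.ofReal ((ν ∗ ρ).real {w.1 + w.2} / ρ.real {w.2}) * ENNReal.ofReal η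
  have hF₁ : Measurable F₁ := (hrm.div hpm).ennreal_ofReal.mul
    ((measurable_one.indicator (measurableSet_singleton b)).comp measurable_snd)
  have hF₂ : Measurable F₂ := (hrm.div hqm).ennreal_ofReal.mul_const _
  calc _ ≤ ∫⁻ w, (F₁ w + F₂ w) ∂(ν.prod ρ) := by
        refine lintegral_mono fun w => ?_
        by_cases hw : w.2 = b
        · refine le_add_right (le_of_eq ?_)
          simp [F₁, hw]
        · refine le_add_left (le_of_eq ?_)
          simp only [F₂, hw, if_false]
          rw [← ENNReal.ofReal_mul (by positivity), div_div_eq_mul_div, mul_div_right_comm]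
    _ = ∫⁻ w, F₁ w ∂(ν.prod ρ) + ∫⁻ w, F₂ w ∂(ν.prod ρ) := lintegral_add_left hF₁ _
    _ ≤ ρ {b} + ENNReal.ofReal η := by
        refine add_le_add ?_ ?_
        · rw [lintegral_prod_symm _ hF₁.aemeasurable]
          calc _ ≤ ∫⁻ y, ({b} : Set ℝ).indicator 1 y ∂ρ := by
                refine lintegral_mono fun y => ?_
                refine (lintegral_div_mul_le hν (hν.conv hρ) y
                  fun _ => ({b} : Set ℝ).indicator 1 y).trans ?_
                simp
            _ = ρ {b} := lintegral_indicator_one (measurableSet_singleton b)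
        · rw [lintegral_prod _ hF₂.aemeasurable]
          calc _ ≤ ∫⁻ _, ENNReal.ofReal η ∂ν := by
                refine lintegral_mono fun x => ?_
                refine le_trans (le_of_eq (lintegral_congr fun y => ?_))
                  ((lintegral_div_mul_le hρ (hν.conv hρ) x fun _ => ENNReal.ofReal η).trans ?_)
                · simp only [F₂, add_comm]
                · simp
            _ = ENNReal.ofReal η := by simp
    _ = ENNReal.ofReal 1 := by
        rw [← ofReal_measureReal, ← ENNReal.ofReal_add measureReal_nonneg hη0, hη]
        congr 1; ring

/-- Revealing whether Y = b can only lower the entropy of X+Y. Given Y = b it is H(X); otherwise it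
is at least H(Y | Y ≠ b), whose weighted value is H(Y) minus the binary entropy of 1 - ρ{b}. -/
lemma natEntropy_conv_ge_of_atom (hν : IsDiscreteMeasure ν) (hρ : IsDiscreteMeasure ρ)
    (hA : natEntropy ν < ∞) (hB : natEntropy ρ < ∞) (hR : natEntropy (ν ∗ ρ) < ∞) (b : ℝ) :
    ρ.real {b} * (natEntropy ν).toReal + (natEntropy ρ).toReal
        - Real.binEntropy (1 - ρ.real {b}) ≤ (natEntropy (ν ∗ ρ)).toReal := by
  set η := 1 - ρ.real {b} with hη
  set β := ρ.real {b} with hβ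
  have hpm : Measurable fun w : ℝ × ℝ => ν.real {w.1} :=
    (measurable_measureReal_singleton ν).comp measurable_fst
  have hqm : Measurable fun w : ℝ × ℝ => ρ.real {w.2} :=
    (measurable_measureReal_singleton ρ).comp measurable_snd
  have hb : MeasurableSet {w : ℝ × ℝ | w.2 = b} := measurable_snd (measurableSet_singleton b)
  have hk : Measurable fun w : ℝ × ℝ => if w.2 = b then ν.real {w.1} else ρ.real {w.2} / η :=
    hpm.ite hb (hqm.div_const η)
  have hcompl : ρ.real {b}ᶜ = η := by rw [probReal_compl_eq_one_sub (measurableSet_singleton b)]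
  have hηb : ∀ᵐ y ∂ρ, y ≠ b → 0 < η := by
    rcases (sub_nonneg.2 (measureReal_le_one (μ := ρ) (s := {b}))).eq_or_lt with h | h
    · have h0 : ρ {b}ᶜ = 0 := by
        rw [← measureReal_eq_zero_iff, hcompl, hη, h]
      filter_upwards [measure_eq_zero_iff_ae_notMem.1 h0] with y hy hyb
      exact absurd hyb hy
    · exact ae_of_all _ fun _ _ => h
  have hae := (ae_prod_measureReal_pos hν hρ).and
    (Measure.quasiMeasurePreserving_snd (μ := ν).ae hηb)
  have hpos : ∀ᵐ w : ℝ × ℝ ∂(ν.prod ρ),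
      0 < if w.2 = b then ν.real {w.1} else ρ.real {w.2} / η := by
    filter_upwards [hae] with w hw
    split_ifs with h
    · exact hw.1.1
    · exact div_pos hw.1.2 (hw.2 h)
  let f₁ : ℝ × ℝ → ℝ := fun w => Real.log (ν.real {w.1}) * ({b} : Set ℝ).indicator 1 w.2
  let f₂ : ℝ → ℝ := fun y => Real.log (ρ.real {y}) - ({b} : Set ℝ).indicator (fun _ => Real.log β) y
    - ({b}ᶜ : Set ℝ).indicator (fun _ => Real.log η) y
  have hlog : (fun w : ℝ × ℝ => Real.log (if w.2 = b then ν.real {w.1} else ρ.real {w.2} / η))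
      =ᵐ[ν.prod ρ] fun w => f₁ w + f₂ w.2 := by
    filter_upwards [hae] with w hw
    by_cases h : w.2 = b
    · simp [f₁, f₂, h, hβ]
    · simp [f₁, f₂, h, Real.log_div hw.1.2.ne' (hw.2 h).ne']
  have hi₀ : Integrable (({b} : Set ℝ).indicator (1 : ℝ → ℝ)) ρ :=
    (integrable_const 1).indicator (measurableSet_singleton b)
  have hi₁ : Integrable f₁ (ν.prod ρ) := (integrable_log_of_natEntropy_lt_top hA).mul_prod hi₀
  have hiβ : Integrable (({b} : Set ℝ).indicator (fun _ => Real.log β)) ρ :=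
    (integrable_const _).indicator (measurableSet_singleton b)
  have hiη : Integrable (({b}ᶜ : Set ℝ).indicator (fun _ => Real.log η)) ρ :=
    (integrable_const _).indicator (measurableSet_singleton b).compl
  have hiρ := integrable_log_of_natEntropy_lt_top hB
  have hi₃ : Integrable (fun y => Real.log (ρ.real {y}) -
    ({b} : Set ℝ).indicator (fun _ => Real.log β) y) ρ := hiρ.sub hiβ
  have hi₂ : Integrable f₂ ρ := hi₃.sub hiη
  have he₁ : ∫ w, f₁ w ∂(ν.prod ρ) = -(natEntropy ν).toReal * β := by
    rw [integral_prod_mul (fun x => Real.log (ν.real {x})) (({b} : Set ℝ).indicator 1),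
      integral_indicator_one (measurableSet_singleton b),
      ← integral_neg_log_eq_toReal_natEntropy, integral_neg, neg_neg]
  have he₂ : ∫ y, f₂ y ∂ρ = -(natEntropy ρ).toReal - β * Real.log β - η * Real.log η := by
    simp only [f₂]
    rw [integral_sub hi₃ hiη, integral_sub hiρ hiβ,
      integral_indicator_const _ (measurableSet_singleton b),
      integral_indicator_const _ (measurableSet_singleton b).compl, hcompl,
      ← integral_neg_log_eq_toReal_natEntropy, integral_neg, neg_neg, smul_eq_mul, smul_eq_mul]
  have key := integral_neg_log_le_of_lintegral_le hν hρ hR hk hpos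
    ((hi₁.add (hi₂.comp_snd ν)).congr hlog.symm) zero_le_one
    (lintegral_conv_div_atom_le hν hρ b)
  rw [integral_neg, integral_congr_ae hlog, integral_add hi₁ (hi₂.comp_snd ν), he₁,
    integral_fun_snd f₂, he₂, probReal_univ, one_smul] at key
  have hbin : Real.binEntropy η = -(η * Real.log η) - β * Real.log β := by
    have : 1 - η = β := by rw [hη]; ring
    rw [Real.binEntropy_eq_negMulLog_add_negMulLog_one_sub, this, Real.negMulLog, Real.negMulLog]
    ring
  rw [hbin]
  linarith

end AtomBound

/-! ### Binary entropy near zero, and cuts near the median -/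

/-- The bound 5x^(3/4) without fractional powers. The exponent 3/4 matches the cubic gain from a
cut: together they give the fourth power in the theorem. -/
lemma binEntropy_pow_four_le {x : ℝ} (h0 : 0 ≤ x) (h1 : x ≤ 1) :
    Real.binEntropy x ^ 4 ≤ 625 * x ^ 3 := by
  obtain ⟨s, hs0, rfl⟩ : ∃ s : ℝ, 0 ≤ s ∧ s ^ 4 = x :=
    ⟨x ^ (1 / 4 : ℝ), by positivity, by
      rw [← Real.rpow_natCast, ← Real.rpow_mul h0]; norm_num⟩
  have hs1 : s ≤ 1 := by
    by_contra h
    exact absurd h1 (not_le.2 (one_lt_pow₀ (not_le.1 h) (by norm_num)))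
  have hn : ∀ t : ℝ, 0 ≤ t → Real.negMulLog t ≤ 1 - t := fun t ht => by
    rcases ht.eq_or_lt with rfl | ht
    · simp
    · have := Real.one_sub_inv_le_log_of_pos ht
      have h2 : t * (1 - t⁻¹) = t - 1 := by field_simp
      have h3 := mul_le_mul_of_nonneg_left this ht.le
      rw [Real.negMulLog]
      linarith
  have h2 : Real.negMulLog (s ^ 4) ≤ 4 * s ^ 3 := by
    have h3 : Real.negMulLog (s ^ 4) = 4 * s ^ 3 * Real.negMulLog s := by
      rw [Real.negMulLog, Real.negMulLog, Real.log_pow]; push_cast; ring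
    rw [h3]
    exact mul_le_of_le_one_right (by positivity) ((hn s hs0).trans (by linarith))
  have h3 := hn (1 - s ^ 4) (by linarith)
  have h4 : s ^ 4 ≤ s ^ 3 := pow_le_pow_of_le_one hs0 hs1 (by norm_num)
  have h5 : Real.binEntropy (s ^ 4) ≤ 5 * s ^ 3 := by
    rw [Real.binEntropy_eq_negMulLog_add_negMulLog_one_sub]; linarith
  calc Real.binEntropy (s ^ 4) ^ 4 ≤ (5 * s ^ 3) ^ 4 :=
        pow_le_pow_left₀ (Real.binEntropy_nonneg h0 h1) h5 4
    _ = 625 * (s ^ 4) ^ 3 := by ring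

/-- A cut at (or just below) the median leaves on both sides a fixed fraction of the mass outside
of one atom. -/
lemma exists_cut (ν : Measure ℝ) [IsProbabilityMeasure ν] :
    ∃ x a : ℝ, (1 - ν.real {x}) / 4 ≤ ν.real (Iic a) ∧
      (1 - ν.real {x}) / 4 ≤ 1 - ν.real (Iic a) := by
  have hbot := tendsto_cdf_atBot ν
  have htop := tendsto_cdf_atTop ν
  have hmono : Monotone fun x => ν.real (Iic x) := fun x y h =>
    measureReal_mono (Iic_subset_Iic.2 h)
  let M : Set ℝ := {x | 1 / 2 ≤ ν.real (Iic x)}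
  obtain ⟨u, hu⟩ := (htop.eventually (lt_mem_nhds (by norm_num : (1 / 2 : ℝ) < 1))).exists
  obtain ⟨l, hl⟩ := (hbot.eventually (gt_mem_nhds (by norm_num : (0 : ℝ) < 1 / 2))).exists
  rw [cdf_eq_real] at hu hl
  have hM : M.Nonempty := ⟨u, hu.le⟩
  have hMb : BddBelow M := ⟨l, fun x hx => le_of_not_gt fun h =>
    absurd (hmono h.le) (not_le.2 (hl.trans_le hx))⟩
  set m := sInf M with hm
  have hlt : ∀ x < m, ν.real (Iic x) < 1 / 2 := fun x hx =>
    not_le.1 fun h => absurd (csInf_le hMb h) (not_le.2 hx)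
  have hgt : ∀ x > m, 1 / 2 ≤ ν.real (Iic x) := fun x hx => by
    obtain ⟨y, hy, hyx⟩ := exists_lt_of_csInf_lt hM hx
    exact le_trans hy (hmono hyx.le)
  have hmm : 1 / 2 ≤ ν.real (Iic m) := by
    have hc := (cdf ν).right_continuous m
    have hc' : Filter.Tendsto (cdf ν) (nhdsWithin m (Ioi m)) (nhds (cdf ν m)) :=
      hc.mono_left (nhdsWithin_mono _ Ioi_subset_Ici_self)
    rw [← cdf_eq_real]
    refine ge_of_tendsto hc' ?_
    filter_upwards [self_mem_nhdsWithin] with x hx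
    rw [cdf_eq_real]; exact hgt x hx
  have hsplit : ν.real (Iic m) = ν.real (Iio m) + ν.real {m} := by
    rw [← Iio_union_right, measureReal_union (by simp) (measurableSet_singleton m)]
  -- If too little mass lies above m, then almost all of the mass outside {m} lies strictly below m.
  -- A cut slightly below m captures a quarter of it and still leaves more than 1/2 above.
  by_cases hcase : (1 - ν.real {m}) / 4 ≤ 1 - ν.real (Iic m)
  · refine ⟨m, m, ?_, hcase⟩
    linarith [measureReal_nonneg (μ := ν) (s := {m})]
  · have hL : (1 - ν.real {m}) / 4 < ν.real (Iio m) := by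
      linarith [measureReal_le_one (μ := ν) (s := {m})]
    obtain ⟨v, hvm, hvlt, hvt⟩ := exists_seq_strictMono_tendsto m
    have hU : ⋃ n, Iic (v n) = Iio m := by
      refine iUnion_Iic_eq_Iio_of_lt_of_tendsto hvlt hvt
    have ht : Filter.Tendsto (fun n => ν.real (Iic (v n))) Filter.atTop
        (nhds (ν.real (Iio m))) := by
      rw [← hU]
      exact (ENNReal.tendsto_toReal (measure_ne_top _ _)).comp
        (tendsto_measure_iUnion_atTop fun i j h => Iic_subset_Iic.2 (hvm.monotone h))
    obtain ⟨n, hn⟩ := (ht.eventually (lt_mem_nhds hL)).exists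
    refine ⟨m, v n, hn.le, ?_⟩
    linarith [hlt _ (hvlt n), measureReal_nonneg (μ := ν) (s := {m})]

/-! ### The entropy gap for two discrete laws -/

section EntropyGap

variable {ν ρ : Measure ℝ} [IsProbabilityMeasure ν] [IsProbabilityMeasure ρ]

/-- Here u and w are the masses of {X+Y ≤ a+b} in the two mixed quadrants, and u', w' their
fractions of those quadrants. The covariances are β(1-β)(α(1-u') + (1-α)w') and α(1-α)(β(1-w') +
(1-β)u'); the two brackets sum to at least 2t, so they cannot both be below t. -/
lemma le_covariance_of_cut {α β t u w : ℝ} (hα : t ≤ α) (hα' : t ≤ 1 - α) (hβ : t ≤ β)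
    (hβ' : t ≤ 1 - β) (ht : 0 < t) (hu0 : 0 ≤ u) (hw0 : 0 ≤ w) (hu : u ≤ α * (1 - β))
    (hw : w ≤ (1 - α) * β) :
    t * (β * (1 - β)) ≤ α * β + w - (α * β + u + w) * β ∨
      t * (α * (1 - α)) ≤ α * β + u - (α * β + u + w) * α := by
  by_contra! h
  obtain ⟨h1, h2⟩ := h
  have hα0 : 0 < α := ht.trans_le hα
  have hβ0 : 0 < β := ht.trans_le hβ
  have hα1 : 0 < 1 - α := ht.trans_le hα'
  have hβ1 : 0 < 1 - β := ht.trans_le hβ'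
  obtain ⟨u', rfl⟩ : ∃ u', u = α * (1 - β) * u' := ⟨u / (α * (1 - β)), by field_simp⟩
  obtain ⟨w', rfl⟩ : ∃ w', w = (1 - α) * β * w' := ⟨w / ((1 - α) * β), by field_simp⟩
  have hu1 : u' ≤ 1 := by
    by_contra hc
    exact absurd hu (not_le.2 (lt_mul_of_one_lt_right (by positivity) (not_le.1 hc)))
  have hw1 : w' ≤ 1 := by
    by_contra hc
    exact absurd hw (not_le.2 (lt_mul_of_one_lt_right (by positivity) (not_le.1 hc)))
  have hu0' : 0 ≤ u' := by
    by_contra hc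
    exact absurd hu0 (not_le.2 (mul_neg_of_pos_of_neg (by positivity) (not_le.1 hc)))
  have hw0' : 0 ≤ w' := by
    by_contra hc
    exact absurd hw0 (not_le.2 (mul_neg_of_pos_of_neg (by positivity) (not_le.1 hc)))
  have h3 : β * (1 - β) * (α * (1 - u') + (1 - α) * w') < β * (1 - β) * t := by linarith
  have h4 : α * (1 - α) * (β * (1 - w') + (1 - β) * u') < α * (1 - α) * t := by linarith
  have h5 := lt_of_mul_lt_mul_left h3 (by positivity)
  have h6 := lt_of_mul_lt_mul_left h4 (by positivity)
  have a1 := mul_le_mul_of_nonneg_right hα (sub_nonneg.2 hu1)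
  have a2 := mul_le_mul_of_nonneg_right hα' hw0'
  have a3 := mul_le_mul_of_nonneg_right hβ (sub_nonneg.2 hw1)
  have a4 := mul_le_mul_of_nonneg_right hβ' hu0'
  linarith

/-- One of the two marginals gains t³/8 from its covariance, the other loses nothing by
monotonicity; averaging halves the gain. -/
lemma natEntropy_conv_ge_of_cut (hν : IsDiscreteMeasure ν) (hρ : IsDiscreteMeasure ρ)
    (hA : natEntropy ν < ∞) (hB : natEntropy ρ < ∞) (hR : natEntropy (ν ∗ ρ) < ∞) {a b t : ℝ}
    (ht : 0 < t) (hα : t ≤ ν.real (Iic a)) (hα' : t ≤ 1 - ν.real (Iic a))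
    (hβ : t ≤ ρ.real (Iic b)) (hβ' : t ≤ 1 - ρ.real (Iic b)) :
    ((natEntropy ν).toReal + (natEntropy ρ).toReal) / 2 + t ^ 3 / 16 ≤
      (natEntropy (ν ∗ ρ)).toReal := by
  have hRA := toReal_natEntropy_le_conv hν hρ hA hR
  have hR' : natEntropy (ρ ∗ ν) < ∞ := by rwa [Measure.conv_comm]
  have hRB := toReal_natEntropy_le_conv hρ hν hB hR'
  rw [Measure.conv_comm] at hRB
  have hadd : Measurable fun w : ℝ × ℝ => w.1 + w.2 := by fun_prop
  let S : Set (ℝ × ℝ) := {w | w.1 + w.2 ∈ Iic (a + b)}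
  have hS : MeasurableSet S := hadd measurableSet_Iic
  have hIa : MeasurableSet (Iic a) := measurableSet_Iic
  have hIb : MeasurableSet (Iic b) := measurableSet_Iic
  set P := ν.prod ρ with hP
  set u := P.real (S ∩ Iic a ×ˢ Ioi b) with hu
  set w := P.real (S ∩ Ioi a ×ˢ Iic b) with hw
  set α := ν.real (Iic a) with hαd
  set β := ρ.real (Iic b) with hβd
  have hαc : ν.real (Ioi a) = 1 - α := by
    rw [← compl_Iic, probReal_compl_eq_one_sub hIa]
  have hβc : ρ.real (Ioi b) = 1 - β := by
    rw [← compl_Iic, probReal_compl_eq_one_sub hIb]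
  have hu1 : u ≤ α * (1 - β) := by
    rw [← hβc, hαd, ← measureReal_prod_prod]
    exact measureReal_mono inter_subset_right
  have hw1 : w ≤ (1 - α) * β := by
    rw [← hαc, hβd, ← measureReal_prod_prod]
    exact measureReal_mono inter_subset_right
  have hSB : P.real {w | w.1 + w.2 ∈ Iic (a + b) ∧ w.2 ∈ Iic b} = α * β + w := by
    rw [hαd, hβd, ← measureReal_prod_prod, hw, ← measureReal_union _
      (hS.inter (measurableSet_Ioi.prod hIb))]
    · congr 1
      ext ⟨x, y⟩
      simp only [S, mem_ofPred_eq, mem_Iic, mem_union, mem_prod, mem_inter_iff, mem_Ioi]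
      constructor
      · rintro ⟨h1, h2⟩
        rcases le_or_gt x a with h | h
        · exact Or.inl ⟨h, h2⟩
        · exact Or.inr ⟨h1, h, h2⟩
      · rintro (⟨h1, h2⟩ | ⟨h1, -, h2⟩)
        · exact ⟨add_le_add h1 h2, h2⟩
        · exact ⟨h1, h2⟩
    · rw [disjoint_left]
      rintro ⟨x, y⟩ h1 h2
      exact (mem_Ioi.1 h2.2.1).not_ge h1.1
  have hSA : P.real {w | w.1 + w.2 ∈ Iic (a + b) ∧ w.1 ∈ Iic a} = α * β + u := by
    rw [hαd, hβd, ← measureReal_prod_prod, hu, ← measureReal_union _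
      (hS.inter (hIa.prod measurableSet_Ioi))]
    · congr 1
      ext ⟨x, y⟩
      simp only [S, mem_ofPred_eq, mem_Iic, mem_union, mem_prod, mem_inter_iff, mem_Ioi]
      constructor
      · rintro ⟨h1, h2⟩
        rcases le_or_gt y b with h | h
        · exact Or.inl ⟨h2, h⟩
        · exact Or.inr ⟨h1, h2, h⟩
      · rintro (⟨h1, h2⟩ | ⟨h1, h2, -⟩)
        · exact ⟨add_le_add h1 h2, h1⟩
        · exact ⟨h1, h2⟩
    · rw [disjoint_left]
      rintro ⟨x, y⟩ h1 h2
      exact (mem_Ioi.1 h2.2.2).not_ge h1.2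
  have hs : (ν ∗ ρ).real (Iic (a + b)) = α * β + u + w := by
    rw [Measure.conv, map_measureReal_apply hadd measurableSet_Iic, ← hSA, hw,
      ← measureReal_union _ (hS.inter (measurableSet_Ioi.prod hIb))]
    · congr 1
      ext ⟨x, y⟩
      simp only [S, mem_ofPred_eq, mem_Iic, mem_union, mem_prod, mem_inter_iff, mem_Ioi,
        mem_preimage]
      constructor
      · intro h1
        rcases le_or_gt x a with h | h
        · exact Or.inl ⟨h1, h⟩
        · exact Or.inr ⟨h1, h, by linarith⟩
      · rintro (h | h)
        · exact h.1
        · exact h.1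
    · rw [disjoint_left]
      rintro ⟨x, y⟩ h1 h2
      exact (mem_Ioi.1 h2.2.1).not_ge h1.2
  have hsw : (ρ.prod ν).real {w | w.1 + w.2 ∈ Iic (a + b) ∧ w.2 ∈ Iic a} =
      P.real {w | w.1 + w.2 ∈ Iic (a + b) ∧ w.1 ∈ Iic a} := by
    have hm : MeasurableSet {w : ℝ × ℝ | w.1 + w.2 ∈ Iic (a + b) ∧ w.2 ∈ Iic a} :=
      (hadd measurableSet_Iic).inter (measurable_snd hIa)
    rw [hP, ← Measure.prod_swap, map_measureReal_apply measurable_swap hm]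
    congr 1
    ext ⟨x, y⟩
    simp [add_comm]
  -- For covariance t·V with variance V, l = t/2 maximises l·tV - l²V, with value t²V/4; `hquad`
  -- then gives V ≥ t/2.
  have h1 := toReal_natEntropy_add_cov_le hν hρ hA hR (measurableSet_Iic (a := a + b)) hIb
    (l := t / 2) (by linarith) (by linarith)
  have h2 := toReal_natEntropy_add_cov_le hρ hν hB hR' (measurableSet_Iic (a := a + b)) hIa
    (l := t / 2) (by linarith) (by linarith)
  rw [hsw, Measure.conv_comm ρ ν, hSA, hs] at h2
  rw [← hP, hSB, hs, ← hβd] at h1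
  rw [← hαd] at h2
  have hquad : ∀ x : ℝ, t ≤ x → t ≤ 1 - x → t / 2 ≤ x * (1 - x) := fun x hx hx' => by
    nlinarith [mul_nonneg (sub_nonneg.2 hx) (sub_nonneg.2 hx')]
  have hfin : ∀ x c : ℝ, t ≤ x → t ≤ 1 - x → t * (x * (1 - x)) ≤ c →
      t ^ 3 / 8 ≤ t / 2 * c - (t / 2) ^ 2 * (x * (1 - x)) := fun x c hx hx' hc => by
    have e1 := mul_le_mul_of_nonneg_left hc (by linarith : 0 ≤ t / 2)
    have e2 := mul_le_mul_of_nonneg_left (hquad x hx hx') (by positivity : 0 ≤ t ^ 2 / 4)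
    linarith
  rcases le_covariance_of_cut hα hα' hβ hβ' ht measureReal_nonneg measureReal_nonneg hu1 hw1 with
    h | h
  · have := hfin β _ hβ hβ' h
    linarith
  · have := hfin α _ hα hα' h
    linarith

lemma natEntropy_conv_ge_or_atom (hν : IsDiscreteMeasure ν) (hρ : IsDiscreteMeasure ρ)
    (hA : natEntropy ν < ∞) (hB : natEntropy ρ < ∞) (hR : natEntropy (ν ∗ ρ) < ∞) {y : ℝ}
    (hy0 : 0 ≤ y) (hy1 : y ≤ 1) (hyA : y ≤ (natEntropy ν).toReal)
    (hyB : y ≤ (natEntropy ρ).toReal) (b : ℝ) :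
    ((natEntropy ν).toReal + (natEntropy ρ).toReal) / 2 + y / 4 ≤
      (natEntropy (ν ∗ ρ)).toReal ∨ y ^ 4 ≤ 10000 * (1 - ρ.real {b}) ^ 3 := by
  have hη0 : 0 ≤ 1 - ρ.real {b} := sub_nonneg.2 measureReal_le_one
  have hη1 : 1 - ρ.real {b} ≤ 1 := sub_le_self _ measureReal_nonneg
  have key := natEntropy_conv_ge_of_atom hν hρ hA hB hR b
  have hbin := binEntropy_pow_four_le hη0 hη1
  set η := 1 - ρ.real {b} with hη
  -- With η ≤ 1/4 and binary entropy at most H(Y)/2, the atom bound gives 3/4 H(X) + 1/2 H(Y).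
  -- Otherwise η is large, directly or since its binary entropy exceeds y/2; 10000 = 2⁴ · 625.
  by_cases h1 : η ≤ 1 / 4
  · by_cases h2 : Real.binEntropy η ≤ (natEntropy ρ).toReal / 2
    · left
      have h3 : 3 / 4 ≤ ρ.real {b} := by linarith
      have h4 := mul_le_mul_of_nonneg_right h3 (hy0.trans hyA)
      linarith
    · right
      have h3 : y / 2 ≤ Real.binEntropy η := by linarith
      have h4 := pow_le_pow_left₀ (by positivity) h3 4
      linarith
  · right
    have h3 : (1 / 4 : ℝ) ^ 3 ≤ η ^ 3 := pow_le_pow_left₀ (by norm_num) (not_le.1 h1).le 3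
    have h4 : y ^ 4 ≤ 1 := pow_le_one₀ hy0 hy1
    linarith

theorem natEntropy_conv_gap (hν : IsDiscreteMeasure ν) (hρ : IsDiscreteMeasure ρ)
    (hA : natEntropy ν < ∞) (hB : natEntropy ρ < ∞) {y : ℝ}
    (hy0 : 0 ≤ y) (hy1 : y ≤ 1) (hyA : y ≤ (natEntropy ν).toReal)
    (hyB : y ≤ (natEntropy ρ).toReal) :
    ((natEntropy ν).toReal + (natEntropy ρ).toReal) / 2 + y ^ 4 / (2 * 10 ^ 7) ≤
      (natEntropy (ν ∗ ρ)).toReal := by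
  have hR : natEntropy (ν ∗ ρ) < ∞ :=
    (natEntropy_conv_le hν hρ).trans_lt (ENNReal.add_lt_top.2 ⟨hA, hB⟩)
  have hR' : natEntropy (ρ ∗ ν) < ∞ := by rwa [Measure.conv_comm]
  have hy4 : y ^ 4 ≤ y := pow_le_of_le_one hy0 hy1 (by norm_num)
  have hy40 : 0 ≤ y ^ 4 := by positivity
  obtain ⟨x₁, a, hα, hα'⟩ := exists_cut ν
  obtain ⟨x₂, b, hβ, hβ'⟩ := exists_cut ρ
  rcases natEntropy_conv_ge_or_atom hν hρ hA hB hR hy0 hy1 hyA hyB x₂ with h | h₂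
  · linarith
  rcases natEntropy_conv_ge_or_atom hρ hν hB hA hR' hy0 hy1 hyB hyA x₁ with h | h₁
  · rw [Measure.conv_comm] at h
    linarith
  -- At y = 0 a law may be a point mass and no cut with t > 0 need exist; monotonicity suffices.
  rcases hy0.eq_or_lt with rfl | hy
  · have h3 := toReal_natEntropy_le_conv hν hρ hA hR
    have h4 := toReal_natEntropy_le_conv hρ hν hB hR'
    rw [Measure.conv_comm] at h4
    norm_num
    linarith
  have hyp : 0 < y ^ 4 := by positivity
  have hpos : ∀ η : ℝ, 0 ≤ η → y ^ 4 ≤ 10000 * η ^ 3 → 0 < η := fun η h0 h => by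
    rcases h0.eq_or_lt with rfl | h0
    · norm_num at h; linarith
    · exact h0
  set η₁ := 1 - ν.real {x₁} with hη₁
  set η₂ := 1 - ρ.real {x₂} with hη₂
  have hp₁ := hpos η₁ (sub_nonneg.2 measureReal_le_one) h₁
  have hp₂ := hpos η₂ (sub_nonneg.2 measureReal_le_one) h₂
  have hmin : y ^ 4 ≤ 10000 * (min η₁ η₂) ^ 3 := by
    rcases min_choice η₁ η₂ with h | h <;> rw [h] <;> assumption
  have hm1 := min_le_left η₁ η₂
  have hm2 := min_le_right η₁ η₂
  have key := natEntropy_conv_ge_of_cut hν hρ hA hB hR (a := a) (b := b)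
    (t := min η₁ η₂ / 4) (div_pos (lt_min hp₁ hp₂) (by norm_num)) (by linarith) (by linarith)
    (by linarith) (by linarith)
  have : (min η₁ η₂ / 4) ^ 3 = (min η₁ η₂) ^ 3 / 64 := by ring
  rw [this] at key
  linarith

/-- The entropy gap for two discrete probability measures, in bits. -/
theorem discreteEntropy_conv_gap (hν : IsDiscreteMeasure ν) (hρ : IsDiscreteMeasure ρ)
    (hA : discreteEntropy ν < ∞) (hB : discreteEntropy ρ < ∞) {y : ℝ}
    (hy0 : 0 ≤ y) (hy1 : y ≤ 1) (hyA : ENNReal.ofReal y ≤ discreteEntropy ν)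
    (hyB : ENNReal.ofReal y ≤ discreteEntropy ρ) :
    (discreteEntropy ν + discreteEntropy ρ) / 2 + ENNReal.ofReal (y ^ 4 / 10 ^ 9) ≤
      discreteEntropy (ν ∗ ρ) := by
  have hl : 0 < Real.log 2 := Real.log_pos (by norm_num)
  have hl1 : 1 / 2 ≤ Real.log 2 := by linarith [Real.log_two_gt_d9]
  have hl2 : Real.log 2 ≤ 1 := by linarith [Real.log_two_lt_d9]
  have hbits : ∀ (τ : Measure ℝ) [IsProbabilityMeasure τ], IsDiscreteMeasure τ →
      discreteEntropy τ < ∞ → natEntropy τ < ∞ ∧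
        (natEntropy τ).toReal = (discreteEntropy τ).toReal * Real.log 2 := by
    intro τ _ hτ hfin
    have h : natEntropy τ = discreteEntropy τ * ENNReal.ofReal (Real.log 2) := by
      rw [hτ.discreteEntropy_eq, ENNReal.div_mul_cancel (by simpa using hl) ENNReal.ofReal_ne_top]
    rw [h, ENNReal.toReal_mul, ENNReal.toReal_ofReal hl.le]
    exact ⟨ENNReal.mul_lt_top hfin ENNReal.ofReal_lt_top, rfl⟩
  obtain ⟨hA', hAe⟩ := hbits ν hν hA
  obtain ⟨hB', hBe⟩ := hbits ρ hρ hB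
  have hR' : natEntropy (ν ∗ ρ) < ∞ :=
    (natEntropy_conv_le hν hρ).trans_lt (ENNReal.add_lt_top.2 ⟨hA', hB'⟩)
  have hR : discreteEntropy (ν ∗ ρ) < ∞ := by
    rw [(hν.conv hρ).discreteEntropy_eq]
    exact ENNReal.div_lt_top hR'.ne (by simpa using hl)
  obtain ⟨-, hRe⟩ := hbits (ν ∗ ρ) (hν.conv hρ) hR
  have hyA' := (ENNReal.ofReal_le_iff_le_toReal hA.ne).1 hyA
  have hyB' := (ENNReal.ofReal_le_iff_le_toReal hB.ne).1 hyB
  have key := natEntropy_conv_gap hν hρ hA' hB' (y := y * Real.log 2) (by positivity)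
    (mul_le_one₀ hy1 hl.le hl2)
    (by rw [hAe]; exact mul_le_mul_of_nonneg_right hyA' hl.le)
    (by rw [hBe]; exact mul_le_mul_of_nonneg_right hyB' hl.le)
  rw [hAe, hBe, hRe] at key
  -- Passing from nats to bits turns y⁴ into y⁴ (log 2)³, and (log 2)³ ≥ 1/8.
  have h3 : (1 / 2 : ℝ) ^ 3 ≤ Real.log 2 ^ 3 := pow_le_pow_left₀ (by norm_num) hl1 3
  have h4 : y ^ 4 / 10 ^ 9 ≤ y ^ 4 * Real.log 2 ^ 3 / (2 * 10 ^ 7) := by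
    have h0 : 0 ≤ y ^ 4 := by positivity
    calc y ^ 4 / 10 ^ 9 ≤ y ^ 4 * (1 / 2) ^ 3 / (2 * 10 ^ 7) := by
          rw [mul_div_assoc, div_eq_mul_inv]
          exact mul_le_mul_of_nonneg_left (by norm_num) h0
      _ ≤ y ^ 4 * Real.log 2 ^ 3 / (2 * 10 ^ 7) := by gcongr
  have h5 : ((discreteEntropy ν).toReal + (discreteEntropy ρ).toReal) / 2 + y ^ 4 / 10 ^ 9 ≤
      (discreteEntropy (ν ∗ ρ)).toReal := by
    refine le_of_mul_le_mul_right ?_ hl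
    have h6 : y ^ 4 / 10 ^ 9 * Real.log 2 ≤ (y * Real.log 2) ^ 4 / (2 * 10 ^ 7) := by
      refine (mul_le_mul_of_nonneg_right h4 hl.le).trans (le_of_eq ?_)
      ring
    linarith
  have hne : (discreteEntropy ν + discreteEntropy ρ) / 2 ≠ ∞ :=
    (ENNReal.div_lt_top (ENNReal.add_lt_top.2 ⟨hA, hB⟩).ne (by norm_num)).ne
  rw [← ENNReal.toReal_le_toReal (ENNReal.add_ne_top.2 ⟨hne, ENNReal.ofReal_ne_top⟩) hR.ne,
    ENNReal.toReal_add hne ENNReal.ofReal_ne_top, ENNReal.toReal_ofReal (by positivity),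
    ENNReal.toReal_div, ENNReal.toReal_add hA.ne hB.ne]
  simpa using h5

lemma discreteEntropy_conv_le (hν : IsDiscreteMeasure ν) (hρ : IsDiscreteMeasure ρ) :
    discreteEntropy (ν ∗ ρ) ≤ discreteEntropy ν + discreteEntropy ρ := by
  rw [hν.discreteEntropy_eq, hρ.discreteEntropy_eq, (hν.conv hρ).discreteEntropy_eq,
    ← ENNReal.add_div]
  exact ENNReal.div_le_div_right (natEntropy_conv_le hν hρ) _

lemma discreteEntropy_le_conv (hν : IsDiscreteMeasure ν) (hρ : IsDiscreteMeasure ρ)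
    (hA : discreteEntropy ν < ∞) (hB : discreteEntropy ρ < ∞) :
    discreteEntropy ν ≤ discreteEntropy (ν ∗ ρ) := by
  have hl : 0 < Real.log 2 := Real.log_pos (by norm_num)
  rw [hν.discreteEntropy_eq] at hA ⊢
  rw [hρ.discreteEntropy_eq] at hB
  rw [(hν.conv hρ).discreteEntropy_eq]
  have hfin : ∀ z : ℝ≥0∞, z / ENNReal.ofReal (Real.log 2) < ∞ → z < ∞ := fun z hz => by
    by_contra h
    rw [not_lt_top_iff.1 h, ENNReal.top_div_of_ne_top ENNReal.ofReal_ne_top] at hz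
    exact lt_irrefl _ hz
  have hR := (natEntropy_conv_le hν hρ).trans_lt (ENNReal.add_lt_top.2 ⟨hfin _ hA, hfin _ hB⟩)
  exact ENNReal.div_le_div_right ((ENNReal.toReal_le_toReal (hfin _ hA).ne hR.ne).1
    (toReal_natEntropy_le_conv hν hρ (hfin _ hA) hR)) _

end EntropyGap

/-! ### The conditional law of the sum -/

section ConvKernel

variable {Ω 𝒱 : Type*} [MeasurableSpace Ω] [MeasurableSpace 𝒱]

/-- The kernel `(v, v') ↦ κ v ∗ κ v'`. -/
noncomputable def convKernel (κ : Kernel 𝒱 ℝ) : Kernel (𝒱 × 𝒱) ℝ :=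
  ((κ.comap Prod.fst measurable_fst) ×ₖ (κ.comap Prod.snd measurable_snd)).map
    fun w : ℝ × ℝ => w.1 + w.2

lemma convKernel_apply (κ : Kernel 𝒱 ℝ) [IsMarkovKernel κ] (z : 𝒱 × 𝒱) :
    convKernel κ z = κ z.1 ∗ κ z.2 := by
  rw [convKernel, Kernel.map_apply _ (by fun_prop), Kernel.prod_apply, Kernel.comap_apply,
    Kernel.comap_apply, Measure.conv]

instance (κ : Kernel 𝒱 ℝ) [IsMarkovKernel κ] : IsMarkovKernel (convKernel κ) :=
  ⟨fun z => by rw [convKernel_apply]; infer_instance⟩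

lemma map_pair_eq_prod {μ : Measure Ω} [IsProbabilityMeasure μ] {D D' : Ω → ℝ} {V V' : Ω → 𝒱}
    (hV : Measurable V) (hV' : Measurable V')
    (hind : IndepFun (fun ω => (D ω, V ω)) (fun ω => (D' ω, V' ω)) μ)
    (hid : IdentDistrib (fun ω => (D' ω, V' ω)) (fun ω => (D ω, V ω)) μ μ) :
    μ.map (fun ω => (V ω, V' ω)) = (μ.map V).prod (μ.map V) := by
  have h1 : IndepFun V V' μ := hind.comp measurable_snd measurable_snd
  have h2 : μ.map V' = μ.map V := (hid.comp measurable_snd).map_eq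
  rw [(indepFun_iff_map_prod_eq_prod_map_map hV.aemeasurable hV'.aemeasurable).1 h1, h2]

/-- Disintegrating each independent copy gives the integration order v, d, v', d'; the convolution
kernel needs v, v', d, d'. Tonelli exchanges d and v'. Uniqueness of the disintegration then
identifies the conditional law of D + D'. -/
lemma map_pair_add_eq_compProd {μ : Measure Ω} [IsProbabilityMeasure μ] {D D' : Ω → ℝ}
    {V V' : Ω → 𝒱}
    (hD : Measurable D) (hV : Measurable V) (hD' : Measurable D') (hV' : Measurable V')
    (hind : IndepFun (fun ω => (D ω, V ω)) (fun ω => (D' ω, V' ω)) μ)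
    (hid : IdentDistrib (fun ω => (D' ω, V' ω)) (fun ω => (D ω, V ω)) μ μ) :
    μ.map (fun ω => ((V ω, V' ω), D ω + D' ω)) =
      μ.map (fun ω => (V ω, V' ω)) ⊗ₘ convKernel (condDistrib D V μ) := by
  have : IsProbabilityMeasure (μ.map V) := Measure.isProbabilityMeasure_map hV.aemeasurable
  have hDV : Measurable fun ω => (D ω, V ω) := hD.prodMk hV
  have hDV' : Measurable fun ω => (D' ω, V' ω) := hD'.prodMk hV'
  have hM : μ.map (fun ω => (D ω, V ω)) = (μ.map V ⊗ₘ condDistrib D V μ).map Prod.swap := by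
    rw [compProd_map_condDistrib hD.aemeasurable, Measure.map_map measurable_swap (by fun_prop)]
    rfl
  have hprod := (indepFun_iff_map_prod_eq_prod_map_map hDV.aemeasurable hDV'.aemeasurable).1 hind
  rw [hid.map_eq] at hprod
  have hM1 : ∀ f : ℝ × 𝒱 → ℝ≥0∞, Measurable f → ∫⁻ z, f z ∂(μ.map (fun ω => (D ω, V ω))) =
      ∫⁻ v, ∫⁻ d, f (d, v) ∂(condDistrib D V μ v) ∂(μ.map V) := by
    intro f hf
    rw [hM, lintegral_map hf measurable_swap,
      Measure.lintegral_compProd (f := fun w : 𝒱 × ℝ => f w.swap) (hf.comp measurable_swap)]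
    rfl
  have hpm : IsProbabilityMeasure (μ.map (fun ω => (D ω, V ω))) :=
    Measure.isProbabilityMeasure_map hDV.aemeasurable
  refine Measure.ext_of_lintegral _ fun f hf => ?_
  let G : (ℝ × 𝒱) × (ℝ × 𝒱) → (𝒱 × 𝒱) × ℝ := fun z => ((z.1.2, z.2.2), z.1.1 + z.2.1)
  have hG : Measurable G := by fun_prop
  have hfG : Measurable fun z => f (G z) := hf.comp hG
  have h1 : ∫⁻ z, f z ∂(μ.map (fun ω => ((V ω, V' ω), D ω + D' ω))) =
      ∫⁻ v, ∫⁻ d, ∫⁻ v', ∫⁻ d', f ((v, v'), d + d') ∂(condDistrib D V μ v') ∂(μ.map V)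
        ∂(condDistrib D V μ v) ∂(μ.map V) := by
    have : μ.map (fun ω => ((V ω, V' ω), D ω + D' ω)) =
        (μ.map (fun ω => ((D ω, V ω), (D' ω, V' ω)))).map G := by
      rw [Measure.map_map hG (by fun_prop)]; rfl
    rw [this, lintegral_map hf hG, hprod, lintegral_prod _ hfG.aemeasurable,
      hM1 _ hfG.lintegral_prod_right']
    refine lintegral_congr fun v => lintegral_congr fun d => ?_
    exact hM1 (fun y => f (G ((d, v), y))) (hfG.comp measurable_prodMk_left)
  have h2 : ∫⁻ z, f z ∂(μ.map (fun ω => (V ω, V' ω)) ⊗ₘ convKernel (condDistrib D V μ)) =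
      ∫⁻ v, ∫⁻ v', ∫⁻ d, ∫⁻ d', f ((v, v'), d + d') ∂(condDistrib D V μ v')
        ∂(condDistrib D V μ v) ∂(μ.map V) ∂(μ.map V) := by
    rw [Measure.lintegral_compProd hf, map_pair_eq_prod hV hV' hind hid,
      lintegral_prod _ hf.lintegral_kernel_prod_right'.aemeasurable]
    refine lintegral_congr fun v => lintegral_congr fun v' => ?_
    rw [convKernel_apply]
    exact Measure.lintegral_conv (f := fun b => f ((v, v'), b)) (hf.comp measurable_prodMk_left)
  rw [h1, h2]
  refine lintegral_congr fun v => ?_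
  refine lintegral_lintegral_swap (f := fun d v' =>
    ∫⁻ d', f ((v, v'), d + d') ∂(condDistrib D V μ v')) ?_
  have hw : Measurable fun w : (ℝ × 𝒱) × ℝ => f ((v, w.1.2), w.1.1 + w.2) := hf.comp (by fun_prop)
  exact (hw.lintegral_kernel_prod_right'
    (κ := (condDistrib D V μ).comap Prod.snd measurable_snd)).aemeasurable

lemma condEntropy_add_eq {μ : Measure Ω} [IsProbabilityMeasure μ] {D D' : Ω → ℝ}
    {V V' : Ω → 𝒱}
    (hD : Measurable D) (hV : Measurable V) (hD' : Measurable D') (hV' : Measurable V')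
    (hind : IndepFun (fun ω => (D ω, V ω)) (fun ω => (D' ω, V' ω)) μ)
    (hid : IdentDistrib (fun ω => (D' ω, V' ω)) (fun ω => (D ω, V ω)) μ μ) :
    condEntropy (fun ω => D ω + D' ω) (fun ω => (V ω, V' ω)) μ =
      ∫⁻ z, discreteEntropy (condDistrib D V μ z.1 ∗ condDistrib D V μ z.2)
        ∂((μ.map V).prod (μ.map V)) := by
  rw [condEntropy, ← map_pair_eq_prod hV hV' hind hid]
  refine lintegral_congr_ae ?_
  filter_upwards [condDistrib_ae_eq_of_measure_eq_compProd _ (by fun_prop)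
    (map_pair_add_eq_compProd hD hV hD' hV' hind hid)] with z hz
  rw [hz, convKernel_apply]

end ConvKernel

/-! ### Averaging the gap over pairs of conditioning values -/

section Averaging

variable {𝒱 : Type*} [MeasurableSpace 𝒱] {P : Measure 𝒱} [IsProbabilityMeasure P]

lemma lintegral_prod_half_add {h : 𝒱 → ℝ≥0∞} (hh : Measurable h) :
    ∫⁻ z, (h z.1 + h z.2) / 2 ∂(P.prod P) = ∫⁻ v, h v ∂P := by
  have h1 := (measurePreserving_fst (μ := P) (ν := P)).lintegral_comp hh
  have h2 := (measurePreserving_snd (μ := P) (ν := P)).lintegral_comp hh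
  simp_rw [div_eq_mul_inv]
  rw [lintegral_mul_const (f := fun z : 𝒱 × 𝒱 => h z.1 + h z.2) _ ((hh.comp measurable_fst).add (hh.comp measurable_snd)),
    lintegral_add_left (f := fun z : 𝒱 × 𝒱 => h z.1) (hh.comp measurable_fst), h1, h2, ← two_mul,
    mul_right_comm, ENNReal.mul_inv_cancel (by norm_num) (by norm_num), one_mul]

lemma lintegral_add_le_of_half_le_measure {h : 𝒱 → ℝ≥0∞} (hh : Measurable h)
    {F : 𝒱 × 𝒱 → ℝ≥0∞} {E : Set 𝒱} (hE : MeasurableSet E) (hPE : 1 / 2 ≤ P E) {c : ℝ≥0∞}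
    (hF : ∀ᵐ z ∂(P.prod P), (h z.1 + h z.2) / 2 + (E ×ˢ E).indicator (fun _ => c) z ≤ F z) :
    ∫⁻ v, h v ∂P + c / 4 ≤ ∫⁻ z, F z ∂(P.prod P) := by
  refine le_trans ?_ (lintegral_mono_ae hF)
  rw [lintegral_add_right _ (measurable_const.indicator (hE.prod hE)), lintegral_prod_half_add hh,
    lintegral_indicator_const (hE.prod hE), Measure.prod_prod]
  refine add_le_add le_rfl ?_
  rw [div_eq_mul_inv]
  refine mul_le_mul' le_rfl (le_trans (le_of_eq ?_) (mul_le_mul' hPE hPE))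
  rw [one_div, ← ENNReal.mul_inv (by norm_num) (by norm_num)]
  norm_num

/-- Averaging the maximum over v' gives at least both h v and the overall mean X. Off E, where h v ≤
X/2, this gains X/2, and that set has mass at least 1/2. -/
lemma lintegral_add_le_of_measure_lt_half {h : 𝒱 → ℝ≥0∞} (hh : Measurable h)
    {F : 𝒱 × 𝒱 → ℝ≥0∞} {E : Set 𝒱} (hE : MeasurableSet E) (hPE : P E < 1 / 2)
    (hlow : ∀ v ∉ E, h v ≤ (∫⁻ v, h v ∂P) / 2)
    (hF : ∀ᵐ z ∂(P.prod P), max (h z.1) (h z.2) ≤ F z) :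
    ∫⁻ v, h v ∂P + (∫⁻ v, h v ∂P) / 4 ≤ ∫⁻ z, F z ∂(P.prod P) := by
  set X := ∫⁻ v, h v ∂P with hX
  have hPc : 1 / 2 ≤ P Eᶜ := by
    rw [prob_compl_eq_one_sub hE, one_div, ← ENNReal.one_sub_inv_two]
    exact tsub_le_tsub_left (by rw [← one_div]; exact hPE.le) 1
  have hmax : Measurable fun z : 𝒱 × 𝒱 => max (h z.1) (h z.2) :=
    (hh.comp measurable_fst).max (hh.comp measurable_snd)
  calc X + X / 4 ≤ X + X / 2 * P Eᶜ := by
        refine add_le_add le_rfl ?_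
        rw [div_eq_mul_inv, div_eq_mul_inv, mul_assoc]
        refine mul_le_mul' le_rfl (le_trans (le_of_eq ?_) (mul_le_mul' le_rfl hPc))
        rw [one_div, ← ENNReal.mul_inv (by norm_num) (by norm_num)]
        norm_num
    _ = ∫⁻ v, (h v + Eᶜ.indicator (fun _ => X / 2) v) ∂P := by
        rw [lintegral_add_left hh, lintegral_indicator_const hE.compl]
    _ ≤ ∫⁻ v, ∫⁻ v', max (h v) (h v') ∂P ∂P := by
        refine lintegral_mono fun v => ?_
        have h1 : h v ≤ ∫⁻ v', max (h v) (h v') ∂P := by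
          calc h v = ∫⁻ _, h v ∂P := by simp
            _ ≤ _ := lintegral_mono fun v' => le_max_left _ _
        have h2 : X ≤ ∫⁻ v', max (h v) (h v') ∂P := lintegral_mono fun v' => le_max_right _ _
        by_cases hv : v ∈ E
        · simpa [hv] using h1
        · simp only [mem_compl_iff, hv, not_false_eq_true, indicator_of_mem]
          refine le_trans (add_le_add (hlow v hv) le_rfl) ?_
          rwa [ENNReal.add_halves]
    _ = ∫⁻ z, max (h z.1) (h z.2) ∂(P.prod P) := (lintegral_prod _ hmax.aemeasurable).symm
    _ ≤ _ := lintegral_mono_ae hF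

/-- If `F` dominates the maximum and, up to a gap, the mean of `h v` and `h v'`, then the mean
of `F` exceeds that of `h` by a definite amount. -/
lemma lintegral_add_gap_le {h : 𝒱 → ℝ≥0∞} (hh : Measurable h) (hfin : ∫⁻ v, h v ∂P < ∞)
    {F : 𝒱 × 𝒱 → ℝ≥0∞} (hmax : ∀ᵐ z ∂(P.prod P), max (h z.1) (h z.2) ≤ F z)
    (hgap : ∀ y : ℝ, 0 ≤ y → y ≤ 1 → ∀ᵐ z ∂(P.prod P), ENNReal.ofReal y ≤ h z.1 →
      ENNReal.ofReal y ≤ h z.2 → (h z.1 + h z.2) / 2 + ENNReal.ofReal (y ^ 4 / 10 ^ 9) ≤ F z)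
    (hmean : ∀ᵐ z ∂(P.prod P), (h z.1 + h z.2) / 2 ≤ F z) :
    ∫⁻ v, h v ∂P + ENNReal.ofReal
      (((∫⁻ v, h v ∂P).toReal / (1 + (∫⁻ v, h v ∂P).toReal)) ^ 4 / (64 * 10 ^ 9)) ≤
      ∫⁻ z, F z ∂(P.prod P) := by
  set X := ∫⁻ v, h v ∂P with hX
  set x := X.toReal with hx
  have hx0 : 0 ≤ x := ENNReal.toReal_nonneg
  have hXx : X = ENNReal.ofReal x := (ENNReal.ofReal_toReal hfin.ne).symm
  -- A continuous, strictly increasing minorant of min(x, 1). The threshold q/2 is then admissible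
  -- for the gap (≤ 1) and, off E, for the maximum argument (≤ x/2). The gap (q/2)⁴/10⁹ on mass 1/4
  -- gives 64 · 10⁹.
  set q := x / (1 + x) with hq
  have hq0 : 0 ≤ q := by positivity
  have hqx : q ≤ x := div_le_self hx0 (by linarith)
  have hq1 : q ≤ 1 := div_le_one_of_le₀ (by linarith) (by linarith)
  let E : Set 𝒱 := {v | ENNReal.ofReal (q / 2) ≤ h v}
  have hE : MeasurableSet E := measurableSet_le measurable_const hh
  rcases le_or_gt (1 / 2) (P E) with hP | hP
  · refine le_trans (le_of_eq ?_) (lintegral_add_le_of_half_le_measure hh hE hP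
      (c := ENNReal.ofReal ((q / 2) ^ 4 / 10 ^ 9)) ?_)
    · congr 1
      have h4 : (4 : ℝ≥0∞) = ENNReal.ofReal 4 := by norm_num
      rw [h4, ← ENNReal.ofReal_div_of_pos (by norm_num)]
      congr 1; ring
    · filter_upwards [hgap (q / 2) (by positivity) (by linarith), hmean] with z hz hz'
      by_cases hzE : z ∈ E ×ˢ E
      · rw [indicator_of_mem hzE]
        exact hz hzE.1 hzE.2
      · rwa [indicator_of_notMem hzE, add_zero]
  · refine le_trans (add_le_add le_rfl ?_) (lintegral_add_le_of_measure_lt_half hh hE hP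
      (fun v hv => ?_) hmax)
    · have h4 : (4 : ℝ≥0∞) = ENNReal.ofReal 4 := by norm_num
      rw [← hX, hXx, h4, ← ENNReal.ofReal_div_of_pos (by norm_num)]
      refine ENNReal.ofReal_le_ofReal ?_
      have : q ^ 4 ≤ q := pow_le_of_le_one hq0 hq1 (by norm_num)
      have h0 : 0 ≤ q ^ 4 := by positivity
      linarith
    · have h2 : (2 : ℝ≥0∞) = ENNReal.ofReal 2 := by norm_num
      rw [← hX, hXx, h2, ← ENNReal.ofReal_div_of_pos (by norm_num)]
      exact (not_le.1 hv).le.trans (ENNReal.ofReal_le_ofReal (by linarith))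

end Averaging

/-! ### The conditional entropy gap and the choice of L -/

section Main

variable {Ω 𝒱 : Type*} [MeasurableSpace Ω] [MeasurableSpace 𝒱]

theorem condEntropy_add_gap {μ : Measure Ω} [IsProbabilityMeasure μ] {D D' : Ω → ℝ}
    {V V' : Ω → 𝒱}
    (hD : Measurable D) (hV : Measurable V) (hD' : Measurable D') (hV' : Measurable V')
    (hind : IndepFun (fun ω => (D ω, V ω)) (fun ω => (D' ω, V' ω)) μ)
    (hid : IdentDistrib (fun ω => (D' ω, V' ω)) (fun ω => (D ω, V ω)) μ μ)
    (hdisc : IsDiscreteCond D V μ) (hfin : condEntropy D V μ < ∞) :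
    condEntropy (fun ω => D ω + D' ω) (fun ω => (V ω, V' ω)) μ < ∞ ∧
      condEntropy D V μ + ENNReal.ofReal (((condEntropy D V μ).toReal /
        (1 + (condEntropy D V μ).toReal)) ^ 4 / (64 * 10 ^ 9)) ≤
        condEntropy (fun ω => D ω + D' ω) (fun ω => (V ω, V' ω)) μ := by
  have : IsProbabilityMeasure (μ.map V) := Measure.isProbabilityMeasure_map hV.aemeasurable
  rw [condEntropy_add_eq hD hV hD' hV' hind hid]
  set κ := condDistrib D V μ with hκ
  set P := μ.map V with hP
  -- A measurable version of the entropy of `κ v`, equal to it almost everywhere.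
  let h : 𝒱 → ℝ≥0∞ := fun v => natEntropy (κ v) / ENNReal.ofReal (Real.log 2)
  have hh : Measurable h := (measurable_natEntropy_kernel κ).div_const _
  have hae : ∀ᵐ v ∂P, IsDiscreteMeasure (κ v) ∧ discreteEntropy (κ v) = h v := by
    filter_upwards [hdisc] with v hv
    exact ⟨hv, hv.discreteEntropy_eq⟩
  have hH : condEntropy D V μ = ∫⁻ v, h v ∂P :=
    lintegral_congr_ae (hae.mono fun v hv => hv.2)
  rw [hH] at hfin ⊢
  have hae' : ∀ᵐ v ∂P, IsDiscreteMeasure (κ v) ∧ discreteEntropy (κ v) = h v ∧ h v < ∞ := by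
    filter_upwards [hae, ae_lt_top hh hfin.ne] with v hv hv'
    exact ⟨hv.1, hv.2, hv'⟩
  have hpair : ∀ᵐ z ∂(P.prod P),
      (IsDiscreteMeasure (κ z.1) ∧ discreteEntropy (κ z.1) = h z.1 ∧ h z.1 < ∞) ∧
      (IsDiscreteMeasure (κ z.2) ∧ discreteEntropy (κ z.2) = h z.2 ∧ h z.2 < ∞) :=
    (Measure.quasiMeasurePreserving_fst.ae hae').and (Measure.quasiMeasurePreserving_snd.ae hae')
  have hgap : ∀ y : ℝ, 0 ≤ y → y ≤ 1 → ∀ᵐ z ∂(P.prod P), ENNReal.ofReal y ≤ h z.1 →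
      ENNReal.ofReal y ≤ h z.2 → (h z.1 + h z.2) / 2 + ENNReal.ofReal (y ^ 4 / 10 ^ 9) ≤
        discreteEntropy (κ z.1 ∗ κ z.2) := by
    intro y hy0 hy1
    filter_upwards [hpair] with z ⟨⟨h1, h2, h3⟩, ⟨h4, h5, h6⟩⟩ h7 h8
    rw [← h2] at h3 h7 ⊢
    rw [← h5] at h6 h8 ⊢
    exact discreteEntropy_conv_gap h1 h4 h3 h6 hy0 hy1 h7 h8
  constructor
  · calc ∫⁻ z, discreteEntropy (κ z.1 ∗ κ z.2) ∂(P.prod P)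
        ≤ ∫⁻ z, (h z.1 + h z.2) ∂(P.prod P) := by
          refine lintegral_mono_ae ?_
          filter_upwards [hpair] with z ⟨⟨h1, h2, h3⟩, ⟨h4, h5, h6⟩⟩
          rw [← h2, ← h5]
          exact discreteEntropy_conv_le h1 h4
      _ = ∫⁻ v, h v ∂P + ∫⁻ v, h v ∂P := by
          have e1 := (measurePreserving_fst (μ := P) (ν := P)).lintegral_comp hh
          have e2 := (measurePreserving_snd (μ := P) (ν := P)).lintegral_comp hh
          rw [lintegral_add_left (f := fun z : 𝒱 × 𝒱 => h z.1) (hh.comp measurable_fst), e1, e2]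
      _ < ∞ := ENNReal.add_lt_top.2 ⟨hfin, hfin⟩
  · refine lintegral_add_gap_le hh hfin ?_ hgap ?_
    · filter_upwards [hpair] with z ⟨⟨h1, h2, h3⟩, ⟨h4, h5, h6⟩⟩
      rw [← h2] at h3 ⊢
      rw [← h5] at h6 ⊢
      refine max_le (discreteEntropy_le_conv h1 h4 h3 h6) ?_
      rw [Measure.conv_comm]
      exact discreteEntropy_le_conv h4 h1 h6 h3
    · filter_upwards [hgap 0 le_rfl zero_le_one] with z hz
      simpa using hz (by simp) (by simp)

lemma strictMonoOn_div_one_add : StrictMonoOn (fun x : ℝ => x / (1 + x)) (Ici 0) := by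
  intro x hx y hy hxy
  have hx' : 0 ≤ x := hx
  have hy' : 0 ≤ y := hy
  change x / (1 + x) < y / (1 + y)
  rw [div_lt_div_iff₀ (by linarith) (by linarith)]
  linarith

end Main

theorem mainTheorem4 :
    ∃ L : ℝ → ℝ,
      StrictMonoOn L (Set.Ici 0) ∧
      ContinuousOn L (Set.Ici 0) ∧
      (∀ x : ℝ, 0 ≤ x → (L x = 0 ↔ x = 0)) ∧
      (∀ (Ω : Type u) (𝒱 : Type v) [MeasurableSpace Ω] [MeasurableSpace 𝒱]
        (μ : Measure Ω) [IsProbabilityMeasure μ]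
        (D D' : Ω → ℝ) (V V' : Ω → 𝒱),
        Measurable D → Measurable V → Measurable D' → Measurable V' →
        IndepFun (fun ω => (D ω, V ω)) (fun ω => (D' ω, V' ω)) μ →
        IdentDistrib (fun ω => (D' ω, V' ω)) (fun ω => (D ω, V ω)) μ μ →
        IsDiscreteCond D V μ →
        condEntropy D V μ < ∞ →
        condEntropy (fun ω => D ω + D' ω) (fun ω => (V ω, V' ω)) μ < ∞ ∧
        L (condEntropy D V μ).toReal ≤
          (condEntropy (fun ω => D ω + D' ω) (fun ω => (V ω, V' ω)) μ).toReal
            - (condEntropy D V μ).toReal) ∧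
      (∃ C : ℝ, 0 < C ∧ ∀ x : ℝ, 0 ≤ x → x < 4 → C * x ^ 4 ≤ L x) := by
  refine ⟨fun x => (x / (1 + x)) ^ 4 / (64 * 10 ^ 9), ?_, ?_, ?_, ?_, ?_⟩
  · intro x hx y hy hxy
    have hx' : 0 ≤ x := hx
    have := pow_lt_pow_left₀ (strictMonoOn_div_one_add hx hy hxy) (by positivity)
      (by norm_num : (4 : ℕ) ≠ 0)
    exact div_lt_div_of_pos_right this (by norm_num)
  · refine ((continuousOn_id.div (continuousOn_const.add continuousOn_id) ?_).pow 4).div_const _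
    intro x hx
    have hx' : 0 ≤ x := hx
    exact (add_pos_of_pos_of_nonneg one_pos hx').ne'
  · intro x hx
    have h1 : 1 + x ≠ 0 := by linarith
    simp [h1]
  · intro Ω 𝒱 _ _ μ _ D D' V V' hD hV hD' hV' hind hid hdisc hfin
    obtain ⟨h1, h2⟩ := condEntropy_add_gap hD hV hD' hV' hind hid hdisc hfin
    refine ⟨h1, ?_⟩
    have h3 := ENNReal.toReal_mono h1.ne h2
    rw [ENNReal.toReal_add hfin.ne ENNReal.ofReal_ne_top, ENNReal.toReal_ofReal (by positivity)]
      at h3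
    change ((condEntropy D V μ).toReal / (1 + (condEntropy D V μ).toReal)) ^ 4 / (64 * 10 ^ 9) ≤ _
    linarith
  · refine ⟨1 / (5 ^ 4 * (64 * 10 ^ 9)), by norm_num, fun x hx0 hx4 => ?_⟩
    -- The restriction x < 4 enters only through 1 + x ≤ 5.
    have h1 : x / 5 ≤ x / (1 + x) := div_le_div_of_nonneg_left hx0 (by linarith) (by linarith)
    have h2 := pow_le_pow_left₀ (by positivity) h1 4
    calc 1 / (5 ^ 4 * (64 * 10 ^ 9)) * x ^ 4 = (x / 5) ^ 4 / (64 * 10 ^ 9) := by ring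
      _ ≤ _ := div_le_div_of_nonneg_right h2 (by norm_num)
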